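/- **Definitions.** A *positive hypergraph* $P$ consists of finite sets $P_k$ ($k\ge 0$) of faces, almost all empty, functions $\gamma:P_{k+1}\to P_k$ (codomain) and maps $\delta$ (domain) assigning to each $a\in P_{k+1}$ a non-empty subset $\delta(a)\subseteq P_k$, a singleton if $k=0$. Write $\gamma\delta(a)=\{\gamma(y):y\in\delta(a)\}$ and $\delta\delta(a)=\bigcup_{y\in\delta(a)}\delta(y)$. On $P_k$ let $<^-$ (for $k>0$) be the transitive closure of the relation $\gamma(a)\in\delta(b)$, and let $<^+$ be the transitive closure of the relation "$a\in\delta(\alpha)$ and $\gamma(\alpha)=b$ for some $\alpha\in P_{k+1}$"; on $P_0$ the relation $<^-$ is empty; $\le^\pm$ are the reflexive versions. $P$ is a *positive opetope* if $P_0\neq\emptyset$ and: (globularity) $\{\gamma\gamma(a)\}=\gamma\delta(a)\setminus\delta\delta(a)$ and $\delta\gamma(a)=\delta\delta(a)\setminus\gamma\delta(a)$ for $a$ of dimension $\ge2$; (strictness) each $<^+$ is irreflexive, and $<^+$ is linear on $P_0$; (disjointness) in dimensions $k>0$ no two faces are both $<^-$-comparable and $<^+$-comparable; (pencil linearity) two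 distinct faces of the same positive dimension with the same codomain, or with a common element in their domains, are $<^+$-comparable; (size) $|P_k\setminus\bigcup_{a\in P_{k+1}}\delta(a)|\le1$ for all $k$. The *iterated codomain* $\gamma^{(k)}(p)$ is the $k$-face obtained from $p$ by iterating $\gamma$ if $\dim p>k$, and is $p$ if $\dim p\le k$. A *$\iota$-map* (contraction) $h:Q\to P$ is a function between the sets of all faces with $\dim h(q)\le\dim q$; with $h(\gamma(q))=\gamma^{(k)}(h(q))$ for $q\in Q_{k+1}$; and such that, with $\ker h=\{q:\dim h(q)<\dim q\}$, for every $q$ of positive dimension $h$ restricts to a bijection $\delta(q)\setminus\ker h\to\delta(h(q))$ if $\dim h(q)=\dim q$, to a bijection $\delta(q)\setminus\ker h\to\{h(q)\}$ if $\dim h(q)=\dim q-1$, and $\delta(q)\subseteq\ker h$ if $\dim h(q)<\dim q-1$. A *$\iota$-epimorphism* is a surjective $\iota$-map. Let $\mathbf{pOpe}_{\iota,epi}$ be the category of positive opetopes and $\iota$-epimorphisms. A *tree* is a finite (possibly empty) poset with binary suprema in which any two elements with a common lower bound are comparable; $s\prec t$ means that $t$ covers $s$; $\mathrm{lvs}(t)$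 is the set of leaves (elements covering nothing) that are $\le t$; the cover of a subset $X$ is $\mathrm{cvr}(X)=\{s\notin X: s\prec x\text{ for some }x\in X\}$. A *convex subtree* is an order-convex subset with a largest element; $\mathrm{St}(T)$ is the set of convex subtrees of $T$ ordered by inclusion. A *constellation* is a monotone map $\sigma:T_1\to \mathrm{St}(T_0)$, $T_0,T_1$ trees, which preserves the top element and such that $\sigma(s)\cap\sigma(s')\neq\emptyset$ implies that $s,s'$ are comparable. Its *constellation tree* $T_1\lhd T_0$ is the disjoint sum of $T_1$ (circles $t^\circ$, ordered as in $T_1$) and $T_0$ (vertices $s^\bullet$, pairwise incomparable) with $s^\bullet\le t^\circ$ iff $s\in\sigma(t)$ and never $t^\circ\le s^\bullet$. A *tree complex* $(T,\sigma)$ is a sequence of constellations $\sigma_i:T_{i+1}\to \mathrm{St}(T_i)$, $i\ge0$, with almost all $T_i$ empty and with $T_0$ and the last non-empty $T_n$ singletons. A *tree complex embedding* $f:S\to T$ is a family of order embeddings $f_i:S_i\to T_i$ such that each induced map $\vec f_i=f_{i+1}\lhd f_i:S_{i+1}\lhd S_i\to T_{i+1}\lhd T_i$ is an order embedding preserving binary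 suprema. Let $\mathbf{cTree}$ be the category of tree complexes and their embeddings. **Theorem.** (1) For a positive opetope $P$, the posets $P^*_i=(P_i\setminus\gamma(P_{i+1}),\le^-)$ with $\pi_i(p)=\{s\in P^*_i: s<^+\gamma(p)\}$ for $p\in P^*_{i+1}$ form a tree complex $P^*$. For a $\iota$-epimorphism $f:P\to Q$ and $q\in Q^*_i$ there is a unique $p\in P^*_i$ with $f(p)=q$, and $f^*_i(q)=p$ defines a tree complex embedding $f^*:Q^*\to P^*$. This gives a functor $(-)^*:\mathbf{pOpe}_{\iota,epi}\to\mathbf{cTree}^{op}$. (2) For a tree complex $S$, the sets $S^*_i=S_{i+1}\lhd S_i$ with $\gamma(p)=\sup(\mathrm{lvs}(p)^\circ)$ and $\delta(p)=\mathrm{cvr}(\mathrm{lvs}(p)^\circ)$ for $p\in S^*_{i+1}$, where $\mathrm{lvs}(p)^\circ=\{t^\circ: t^\bullet\in \mathrm{lvs}(p)\}\subseteq S^*_i$, form a positive opetope $S^*$. For a tree complex embedding $f:S\to T$ and $t\in T^*_i$, let $D_i(t)=\{t\}$ and $D_j(t)=\delta(\gamma^{(j+1)}(t))$ for $j<i$;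 let $j\le i$ be the largest number such that $\vec f_j(s')\le t'$ for some $s'\in S^*_j$ and $t'\in D_j(t)$, and let $s$ be the maximal such $s'\in S^*_j$. Then $j$ exists, $s$ is unique, and $f^*(t)=s$ defines a $\iota$-epimorphism $f^*:T^*\to S^*$. This gives a functor $(-)^*:\mathbf{cTree}^{op}\to\mathbf{pOpe}_{\iota,epi}$. (3) These functors are mutually inverse up to natural isomorphism, and hence form an equivalence of categories $\mathbf{pOpe}_{\iota,epi}\simeq\mathbf{cTree}^{op}$: the maps $\varepsilon_P:P^{**}\to P$, $\varepsilon_P(p^\bullet)=p$, $\varepsilon_P(p^\circ)=\gamma(p)$, are the components of a natural isomorphism of functors on $\mathbf{pOpe}_{\iota,epi}$, and the maps $\eta_S:S\to S^{**}$, $\eta_{S,i}(s)=s^\bullet$, are the components of a natural isomorphism of functors on $\mathbf{cTree}$. -/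

import Mathlib

open CategoryTheory

universe u

namespace OpetopeDuality

/-! ### Positive hypergraphs and positive opetopes -/

/-- The data of a positive hypergraph: faces of each dimension, codomains `γ`, domains `δ`. -/
structure PreHypergraph where
  face : ℕ → Type u
  γ : ∀ {k : ℕ}, face (k + 1) → face k
  δ : ∀ {k : ℕ}, face (k + 1) → Set (face k)

namespace PreHypergraph

variable (P : PreHypergraph.{u})

/-- Positive hypergraph: finite sets of faces, almost all of them empty, `δ` total,
and `δ` single-valued on faces of dimension one. -/
structure IsPositiveHypergraph : Prop where
  finite : ∀ k, Finite (P.face k)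
  bounded : ∃ n, ∀ k, n < k → IsEmpty (P.face k)
  δ_nonempty : ∀ {k : ℕ} (a : P.face (k + 1)), (P.δ a).Nonempty
  δ_zero : ∀ a : P.face 1, ∃ x, P.δ a = {x}

/-- One step of the lower order (only in positive dimensions): `γ a ∈ δ b`. -/
def lowerStep : ∀ k : ℕ, P.face k → P.face k → Prop
  | 0, _, _ => False
  | _ + 1, a, b => P.γ a ∈ P.δ b

/-- The lower order `a <⁻ b`. -/
def lower (k : ℕ) : P.face k → P.face k → Prop :=
  Relation.TransGen (P.lowerStep k)

/-- One step of the upper order: `a ∈ δ α` and `γ α = b` for some face `α`. -/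
def upperStep (k : ℕ) (a b : P.face k) : Prop :=
  ∃ α : P.face (k + 1), a ∈ P.δ α ∧ P.γ α = b

/-- The upper order `a <⁺ b`. -/
def upper (k : ℕ) : P.face k → P.face k → Prop :=
  Relation.TransGen (P.upperStep k)

/-- Comparability `a ⊥⁻ b` for the (strict) lower order. -/
def lowerPerp (k : ℕ) (a b : P.face k) : Prop := P.lower k a b ∨ P.lower k b a

/-- Comparability `a ⊥⁺ b` for the (strict) upper order. -/
def upperPerp (k : ℕ) (a b : P.face k) : Prop := P.upper k a b ∨ P.upper k b a

/-- `γδ(a)`. -/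
def γδ {k : ℕ} (a : P.face (k + 2)) : Set (P.face k) := {x | ∃ y ∈ P.δ a, P.γ y = x}

/-- `δδ(a)`. -/
def δδ {k : ℕ} (a : P.face (k + 2)) : Set (P.face k) := {x | ∃ y ∈ P.δ a, x ∈ P.δ y}

/-- Positive opetopic cardinals. -/
structure IsPositiveOpetopicCardinal : Prop extends P.IsPositiveHypergraph where
  nonempty : Nonempty (P.face 0)
  glob_γ : ∀ {k : ℕ} (a : P.face (k + 2)), {P.γ (P.γ a)} = P.γδ a \ P.δδ a
  glob_δ : ∀ {k : ℕ} (a : P.face (k + 2)), P.δ (P.γ a) = P.δδ a \ P.γδ a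
  strict : ∀ (k : ℕ) (a : P.face k), ¬ P.upper k a a
  linear : ∀ a b : P.face 0, a = b ∨ P.upperPerp 0 a b
  disjoint : ∀ (k : ℕ) (a b : P.face (k + 1)),
    ¬ (P.lowerPerp (k + 1) a b ∧ P.upperPerp (k + 1) a b)
  pencil_γ : ∀ {k : ℕ} (a b : P.face (k + 1)), P.γ a = P.γ b →
    a = b ∨ P.upperPerp (k + 1) a b
  pencil_δ : ∀ {k : ℕ} (x : P.face k) (a b : P.face (k + 1)), x ∈ P.δ a → x ∈ P.δ b →
    a = b ∨ P.upperPerp (k + 1) a b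

/-- The size of `P` in dimension `k`: the number of `k`-faces in no domain. -/
noncomputable def size (k : ℕ) : ℕ := {x : P.face k | ∀ a : P.face (k + 1), x ∉ P.δ a}.ncard

/-- Positive opetopes: positive opetopic cardinals of size at most one in each dimension. -/
structure IsPositiveOpetope : Prop extends P.IsPositiveOpetopicCardinal where
  size_le_one : ∀ k, P.size k ≤ 1

/-- The set `|P|` of all faces; the first component of a face is its dimension. -/
abbrev Faces : Type u := Σ k : ℕ, P.face k

variable {P}

/-- The iterated codomain of a face, as a function on faces of a given dimension. -/
def codAux (k : ℕ) : ∀ l : ℕ, P.face l → P.Faces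
  | 0, p => ⟨0, p⟩
  | l + 1, p => if l + 1 ≤ k then ⟨l + 1, p⟩ else codAux k l (P.γ p)

/-- The iterated codomain `γ⁽ᵏ⁾`: the codomain of dimension `k` for faces of dimension
greater than `k`, the identity on all other faces. -/
def codTo (k : ℕ) (p : P.Faces) : P.Faces := codAux k p.1 p.2

/-- The domain `δ(p)` as a set of faces, empty in dimension zero. -/
def dom : P.Faces → Set P.Faces
  | ⟨0, _⟩ => ∅
  | ⟨k + 1, p⟩ => Sigma.mk k '' P.δ p

theorem codTo_of_le {k : ℕ} {p : P.Faces} (h : p.1 ≤ k) : codTo k p = p := by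
  obtain ⟨l, p⟩ := p
  cases l with
  | zero => rfl
  | succ l => exact if_pos h

/-- Faces in the domain have dimension one less. -/
theorem dim_of_mem_dom {p x : P.Faces} (h : x ∈ dom p) : x.1 + 1 = p.1 := by
  obtain ⟨l, p⟩ := p
  cases l with
  | zero => exact h.elim
  | succ l =>
    obtain ⟨y, -, rfl⟩ := h
    rfl

/-- The kernel of a function between faces: the faces whose dimension drops. -/
def ker {Q P : PreHypergraph.{u}} (h : Q.Faces → P.Faces) : Set Q.Faces :=
  {q | (h q).1 < q.1}

/-- Contraction morphisms (`ι`-maps). -/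
structure IsContraction {Q P : PreHypergraph.{u}} (h : Q.Faces → P.Faces) : Prop where
  dim_le : ∀ q, (h q).1 ≤ q.1
  cod : ∀ (k : ℕ) (q : Q.Faces), q.1 = k + 1 → h (codTo k q) = codTo k (h q)
  dom_zero : ∀ q : Q.Faces, 0 < q.1 → (h q).1 = q.1 →
    Set.BijOn h (dom q \ ker h) (dom (h q))
  dom_one : ∀ q : Q.Faces, (h q).1 + 1 = q.1 → Set.BijOn h (dom q \ ker h) {h q}
  dom_many : ∀ q : Q.Faces, (h q).1 + 1 < q.1 → dom q ⊆ ker h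

theorem ker_id : ker (id : P.Faces → P.Faces) = ∅ := by
  ext q
  simp [ker]

theorem IsContraction.id : IsContraction (id : P.Faces → P.Faces) where
  dim_le _ := le_rfl
  cod _ _ _ := rfl
  dom_zero q _ _ := by
    rw [ker_id, Set.sdiff_empty]
    exact Set.bijOn_id _
  dom_one q h := by simp at h
  dom_many q h := by simp only [_root_.id] at h; omega

theorem IsContraction.comp {R Q P : PreHypergraph.{u}} {g : Q.Faces → P.Faces}
    {h : R.Faces → Q.Faces} (hg : IsContraction g) (hh : IsContraction h) :
    IsContraction (g ∘ h) := by
  have hk : ∀ r, r ∈ ker (g ∘ h) ↔ r ∈ ker h ∨ h r ∈ ker g := by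
    intro r
    have h1 := hh.dim_le r
    have h2 := hg.dim_le (h r)
    simp only [ker, Set.mem_ofPred_eq, Function.comp_apply]
    omega
  refine ⟨fun q => (hg.dim_le _).trans (hh.dim_le q), ?_, ?_, ?_, ?_⟩
  · intro k q hq
    simp only [Function.comp_apply]
    rw [hh.cod k q hq]
    rcases (hh.dim_le q).eq_or_lt with h1 | h1
    · exact hg.cod k _ (h1.trans hq)
    · have h2 : (h q).1 ≤ k := by omega
      rw [codTo_of_le h2, codTo_of_le ((hg.dim_le _).trans h2)]
  · intro q hq hd
    have h1 := hh.dim_le q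
    have h2 := hg.dim_le (h q)
    simp only [Function.comp_apply] at hd
    have b1 := hh.dom_zero q hq (by omega)
    have b2 := hg.dom_zero (h q) (by omega) (by omega)
    refine ⟨?_, ?_, ?_⟩
    · intro x hx
      have hx2 := mt (hk x).2 hx.2
      push Not at hx2
      exact b2.mapsTo ⟨b1.mapsTo ⟨hx.1, hx2.1⟩, hx2.2⟩
    · intro x hx y hy hxy
      have hx2 := mt (hk x).2 hx.2
      have hy2 := mt (hk y).2 hy.2
      push Not at hx2 hy2
      exact b1.injOn ⟨hx.1, hx2.1⟩ ⟨hy.1, hy2.1⟩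
        (b2.injOn ⟨b1.mapsTo ⟨hx.1, hx2.1⟩, hx2.2⟩ ⟨b1.mapsTo ⟨hy.1, hy2.1⟩, hy2.2⟩ hxy)
    · intro z hz
      obtain ⟨y, hy, rfl⟩ := b2.surjOn hz
      obtain ⟨x, hx, rfl⟩ := b1.surjOn hy.1
      refine ⟨x, ⟨hx.1, ?_⟩, rfl⟩
      rw [hk]
      exact not_or.2 ⟨hx.2, hy.2⟩
  · intro q hd
    have h1 := hh.dim_le q
    have h2 := hg.dim_le (h q)
    simp only [Function.comp_apply] at hd
    rcases h1.eq_or_lt with h3 | h3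
    · have b1 := hh.dom_zero q (by omega) h3
      have b2 := hg.dom_one (h q) (by omega)
      refine ⟨?_, ?_, ?_⟩
      · intro x hx
        have hx2 := mt (hk x).2 hx.2
        push Not at hx2
        exact b2.mapsTo ⟨b1.mapsTo ⟨hx.1, hx2.1⟩, hx2.2⟩
      · intro x hx y hy hxy
        have hx2 := mt (hk x).2 hx.2
        have hy2 := mt (hk y).2 hy.2
        push Not at hx2 hy2
        exact b1.injOn ⟨hx.1, hx2.1⟩ ⟨hy.1, hy2.1⟩
          (b2.injOn ⟨b1.mapsTo ⟨hx.1, hx2.1⟩, hx2.2⟩ ⟨b1.mapsTo ⟨hy.1, hy2.1⟩, hy2.2⟩ hxy)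
      · intro z hz
        obtain ⟨y, hy, rfl⟩ := b2.surjOn hz
        obtain ⟨x, hx, rfl⟩ := b1.surjOn hy.1
        refine ⟨x, ⟨hx.1, ?_⟩, rfl⟩
        rw [hk]
        exact not_or.2 ⟨hx.2, hy.2⟩
    · have b1 := hh.dom_one q (by omega)
      refine ⟨?_, ?_, ?_⟩
      · intro x hx
        have hx2 := mt (hk x).2 hx.2
        push Not at hx2
        have h4 : h x = h q := b1.mapsTo ⟨hx.1, hx2.1⟩
        simp [h4]
      · intro x hx y hy _
        have hx2 := mt (hk x).2 hx.2
        have hy2 := mt (hk y).2 hy.2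
        push Not at hx2 hy2
        have h4 : h x = h q := b1.mapsTo ⟨hx.1, hx2.1⟩
        have h5 : h y = h q := b1.mapsTo ⟨hy.1, hy2.1⟩
        exact b1.injOn ⟨hx.1, hx2.1⟩ ⟨hy.1, hy2.1⟩ (h4.trans h5.symm)
      · rintro _ rfl
        obtain ⟨x, hx, h4⟩ := b1.surjOn (Set.mem_singleton (h q))
        refine ⟨x, ⟨hx.1, ?_⟩, by simp [h4]⟩
        rw [hk, h4]
        refine not_or.2 ⟨hx.2, ?_⟩
        simp only [ker, Set.mem_ofPred_eq]
        omega
  · intro q hd x hx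
    have h1 := hh.dim_le q
    have h2 := hg.dim_le (h q)
    have hdx := dim_of_mem_dom hx
    simp only [Function.comp_apply] at hd
    rw [hk]
    by_cases hxk : x ∈ ker h
    · exact Or.inl hxk
    right
    rcases h1.eq_or_lt with h3 | h3
    · exact hg.dom_many (h q) (by omega)
        ((hh.dom_zero q (by omega) h3).mapsTo ⟨hx, hxk⟩)
    · by_cases h4 : (h q).1 + 1 = q.1
      · have h5 : h x = h q := (hh.dom_one q h4).mapsTo ⟨hx, hxk⟩
        rw [h5]
        simp only [ker, Set.mem_ofPred_eq]
        omega
      · exact absurd (hh.dom_many q (by omega) hx) hxk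

end PreHypergraph

open PreHypergraph

/-- Positive opetopes. -/
structure PositiveOpetope extends PreHypergraph.{u} where
  isOpetope : toPreHypergraph.IsPositiveOpetope

/-- Contraction epimorphisms (`ι`-epimorphisms): contractions that are onto. -/
@[ext]
structure ContractionEpi (P Q : PositiveOpetope.{u}) where
  toFun : P.Faces → Q.Faces
  isContraction : IsContraction toFun
  surjective : Function.Surjective toFun

/-- The category of positive opetopes and contraction epimorphisms. -/
instance : Category PositiveOpetope.{u} where
  Hom P Q := ContractionEpi P Q
  id P := ⟨id, IsContraction.id, Function.surjective_id⟩
  comp f g := ⟨g.toFun ∘ f.toFun, g.isContraction.comp f.isContraction,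
    g.surjective.comp f.surjective⟩

/-! ### Trees and tree complexes -/

/-- Trees: finite posets with binary suprema in which only chains have infima. (In a finite poset
with binary suprema two elements with a common lower bound have an infimum, so the second
condition says that elements with a common lower bound are comparable.) Empty trees are allowed. -/
structure IsTree (T : Type u) [PartialOrder T] : Prop where
  finite : Finite T
  exists_sup : ∀ a b : T, ∃ c, IsLUB {a, b} c
  comparable : ∀ a b c : T, c ≤ a → c ≤ b → a ≤ b ∨ b ≤ a

section Poset

variable {T : Type u} [PartialOrder T]

/-- Convex subtrees: order-convex subsets with a largest element. -/
def IsConvexSubtree (X : Set T) : Prop :=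
  (∃ m, IsGreatest X m) ∧ X.OrdConnected

/-- A leaf has no sons; `s` is a son of `t` when `s ⋖ t`. -/
def IsLeaf (t : T) : Prop := ∀ s, ¬ s ⋖ t

/-- The leaves over (that is, below or equal to) `t`. -/
def lvs (t : T) : Set T := {s | IsLeaf s ∧ s ≤ t}

/-- The cover of a subset: sons of its elements which are not in it. -/
def cvr (X : Set T) : Set T := {s | ∃ x ∈ X, s ⋖ x} \ X

end Poset

/-- Constellations `σ : A → St(B)`, with `σ a` regarded as a subset of `B`. -/
structure IsConstellation {A B : Type u} [PartialOrder A] [PartialOrder B] (σ : A → Set B) :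
    Prop where
  tree_left : IsTree A
  tree_right : IsTree B
  convex : ∀ a, IsConvexSubtree (σ a)
  monotone : Monotone σ
  map_top : ∀ a, IsTop a → σ a = Set.univ
  comparable : ∀ a a', (σ a ∩ σ a').Nonempty → a ≤ a' ∨ a' ≤ a

/-- The nodes of the constellation tree `A ◁ B`: circles `a°` and vertices `b•`. -/
inductive Node {A B : Type u} (σ : A → Set B) : Type u
  | circle : A → Node σ
  | vertex : B → Node σ

namespace Node

variable {A B : Type u} {σ : A → Set B}

/-- The constellation order. -/
protected def le [LE A] : Node σ → Node σ → Prop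
  | circle a, circle a' => a ≤ a'
  | vertex b, circle a => b ∈ σ a
  | vertex b, vertex b' => b = b'
  | circle _, vertex _ => False

/-- The constellation order is a partial order when `σ` is monotone. -/
abbrev partialOrder [PartialOrder A] (hσ : Monotone σ) : PartialOrder (Node σ) where
  le := Node.le
  le_refl x := by cases x <;> simp [Node.le]
  le_trans x y z := by
    cases x <;> cases y <;> cases z <;> simp only [Node.le]
    · exact le_trans
    all_goals first
      | exact fun h => h.elim
      | exact fun _ h => h.elim
      | exact fun h h' => hσ h' h
      | exact fun h h' => h ▸ h'
  le_antisymm x y := by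
    cases x <;> cases y <;> simp only [Node.le]
    · exact fun h h' => congrArg _ (le_antisymm h h')
    · exact fun h => h.elim
    · exact fun _ h => h.elim
    · exact fun h _ => congrArg _ h

end Node

/-- The data of a tree complex: posets `T 0, T 1, …` and functions `σ i` from `T (i + 1)` to
subsets of `T i`. -/
structure PreTreeComplex where
  T : ℕ → Type u
  [order : ∀ i, PartialOrder (T i)]
  σ : ∀ i : ℕ, T (i + 1) → Set (T i)

attribute [instance] PreTreeComplex.order

/-- Tree complexes: sequences of constellations, with `T 0` and the last nonempty `T n`
singletons. -/
structure PreTreeComplex.IsTreeComplex (S : PreTreeComplex.{u}) : Prop where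
  constellation : ∀ i, IsConstellation (S.σ i)
  bottom : Nat.card (S.T 0) = 1
  top : ∃ n, Nat.card (S.T n) = 1 ∧ ∀ m, n < m → IsEmpty (S.T m)

/-- Tree complexes. -/
structure TreeComplex extends PreTreeComplex.{u} where
  isTreeComplex : toPreTreeComplex.IsTreeComplex

namespace TreeComplex

/-- The constellation tree `S (i + 1) ◁ S i`. -/
abbrev Star (S : TreeComplex.{u}) (i : ℕ) : Type u := Node (S.σ i)

instance (S : TreeComplex.{u}) (i : ℕ) : PartialOrder (Node (S.σ i)) :=
  Node.partialOrder (S.isTreeComplex.constellation i).monotone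

/-- The map `g ◁ f` induced on nodes. -/
def nodeMap {S T : TreeComplex.{u}} (f : ∀ i, S.T i → T.T i) (i : ℕ) : S.Star i → T.Star i
  | .circle a => .circle (f (i + 1) a)
  | .vertex b => .vertex (f i b)

/-- Morphisms of tree complexes: families of tree embeddings such that the induced maps of
constellation trees are tree embeddings which preserve binary suprema. -/
@[ext]
structure Hom (S T : TreeComplex.{u}) where
  app : ∀ i, S.T i → T.T i
  app_le_iff : ∀ (i : ℕ) (a b : S.T i), app i a ≤ app i b ↔ a ≤ b
  nodeMap_le_iff : ∀ (i : ℕ) (x y : S.Star i), nodeMap app i x ≤ nodeMap app i y ↔ x ≤ y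
  map_sup : ∀ (i : ℕ) (x y z : S.Star i), IsLUB {x, y} z →
    IsLUB {nodeMap app i x, nodeMap app i y} (nodeMap app i z)

theorem nodeMap_id {S : TreeComplex.{u}} (i : ℕ) (x : S.Star i) :
    nodeMap (S := S) (T := S) (fun _ a => a) i x = x := by
  cases x <;> rfl

theorem nodeMap_comp {S T U : TreeComplex.{u}} (f : ∀ i, S.T i → T.T i) (g : ∀ i, T.T i → U.T i)
    (i : ℕ) (x : S.Star i) :
    nodeMap (S := S) (T := U) (fun i a => g i (f i a)) i x = nodeMap g i (nodeMap f i x) := by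
  cases x <;> rfl

/-- The category of tree complexes and tree complex embeddings. -/
instance : Category TreeComplex.{u} where
  Hom S T := Hom S T
  id S := ⟨fun _ a => a, fun _ _ _ => Iff.rfl, fun i x y => by simp only [nodeMap_id],
    fun i x y z h => by simpa only [nodeMap_id] using h⟩
  comp f g := ⟨fun i a => g.app i (f.app i a),
    fun i a b => (g.app_le_iff i _ _).trans (f.app_le_iff i a b),
    fun i x y => by
      simp only [nodeMap_comp]
      exact (g.nodeMap_le_iff i _ _).trans (f.nodeMap_le_iff i x y),
    fun i x y z h => by
      simp only [nodeMap_comp]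
      exact g.map_sup i _ _ _ (f.map_sup i x y z h)⟩

end TreeComplex

/-! ### From positive opetopes to tree complexes -/

namespace PositiveOpetope

variable (P : PositiveOpetope.{u})

/-- `P_i - γ(P_{i+1})`. -/
abbrev Dual (i : ℕ) : Type u := {p : P.face i // p ∉ Set.range (P.γ (k := i))}

theorem upper_γ_of_lower {k : ℕ} {a b : P.face (k + 1)} (h : P.lower (k + 1) a b) :
    P.upper k (P.γ a) (P.γ b) := by
  induction h with
  | single h => exact .single ⟨_, h, rfl⟩
  | tail _ h ih => exact ih.tail ⟨_, h, rfl⟩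

theorem lower_irrefl : ∀ {k : ℕ} (a : P.face k), ¬ P.lower k a a
  | 0, _, h => by
    obtain ⟨_, h, _⟩ := Relation.TransGen.head'_iff.1 h
    exact h
  | _ + 1, _, h => P.isOpetope.strict _ _ (P.upper_γ_of_lower h)

/-- The order `≤⁻` on `P_i - γ(P_{i+1})`. -/
instance (i : ℕ) : PartialOrder (P.Dual i) where
  le p q := p = q ∨ P.lower i p.1 q.1
  le_refl p := Or.inl rfl
  le_trans p q r h h' := by
    rcases h with rfl | h
    · exact h'
    · rcases h' with rfl | h'
      · exact Or.inr h
      · exact Or.inr (h.trans h')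
  le_antisymm p q h h' := by
    rcases h with rfl | h
    · rfl
    · rcases h' with rfl | h'
      · rfl
      · exact (P.lower_irrefl _ (h.trans h')).elim

/-- The data of the tree complex `P*`: the posets `P_i - γ(P_{i+1})` ordered by `≤⁻`, with
`π_i(p) = {s | s <⁺ γ(p)}`. -/
def dual : PreTreeComplex.{u} where
  T := P.Dual
  σ i p := {s | P.upper i s.1 (P.γ p.1)}

end PositiveOpetope

/-- The first construction as a contravariant functor: `P` is sent to the tree complex `P*`, and
`f : P ⟶ Q` to the morphism `f* : Q* ⟶ P*` which sends `q` to the unique `p ∈ P_i - γ(P_{i+1})`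
with `f(p) = q`. -/
structure OpetopeToTree where
  isTreeComplex : ∀ P : PositiveOpetope.{u}, P.dual.IsTreeComplex
  map : ∀ {P Q : PositiveOpetope.{u}}, (P ⟶ Q) →
    ((⟨Q.dual, isTreeComplex Q⟩ : TreeComplex.{u}) ⟶ ⟨P.dual, isTreeComplex P⟩)
  map_eq_iff : ∀ {P Q : PositiveOpetope.{u}} (f : P ⟶ Q) (i : ℕ) (q : Q.Dual i) (p : P.Dual i),
    (map f).app i q = p ↔ f.toFun ⟨i, p.1⟩ = ⟨i, q.1⟩
  map_id : ∀ P : PositiveOpetope.{u}, map (𝟙 P) = 𝟙 _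
  map_comp : ∀ {P Q R : PositiveOpetope.{u}} (f : P ⟶ Q) (g : Q ⟶ R),
    map (f ≫ g) = map g ≫ map f

/-- The functor from positive opetopes to the opposite of tree complexes. -/
def OpetopeToTree.functor (A : OpetopeToTree.{u}) :
    PositiveOpetope.{u} ⥤ TreeComplex.{u}ᵒᵖ where
  obj P := Opposite.op ⟨P.dual, A.isTreeComplex P⟩
  map f := (A.map f).op
  map_id P := congrArg Quiver.Hom.op (A.map_id P)
  map_comp f g := congrArg Quiver.Hom.op (A.map_comp f g)

/-! ### From tree complexes to positive opetopes -/

namespace TreeComplex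

/-- For a node `p` of dimension `i + 1`, the set `lvs(p)°`: the leaves over `p`, considered as
circles one dimension below. -/
def lvsCircle (S : TreeComplex.{u}) {i : ℕ} (p : S.Star (i + 1)) : Set (S.Star i) :=
  {c | ∃ t : S.T (i + 1), (Node.vertex t : S.Star (i + 1)) ∈ lvs p ∧ c = Node.circle t}

theorem isLeaf_vertex (S : TreeComplex.{u}) {i : ℕ} (t : S.T i) :
    IsLeaf (Node.vertex t : S.Star i) := by
  intro s hs
  have h := hs.lt
  cases s with
  | circle a => exact h.le
  | vertex b =>
    have hb : b = t := h.le
    subst hb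
    exact lt_irrefl _ h

theorem exists_isLUB_lvsCircle (S : TreeComplex.{u}) {i : ℕ} (p : S.Star (i + 1)) :
    ∃ c, IsLUB (S.lvsCircle p) c := by
  cases p with
  | vertex t =>
    refine ⟨Node.circle t, IsGreatest.isLUB ⟨⟨t, ⟨S.isLeaf_vertex t, le_rfl⟩, rfl⟩, ?_⟩⟩
    rintro _ ⟨t', h, rfl⟩
    have ht : t' = t := h.2
    rw [ht]
  | circle t =>
    obtain ⟨m, hm⟩ := ((S.isTreeComplex.constellation (i + 1)).convex t).1
    refine ⟨Node.circle m, IsGreatest.isLUB ⟨⟨m, ⟨S.isLeaf_vertex m, hm.1⟩, rfl⟩, ?_⟩⟩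
    rintro _ ⟨t', h, rfl⟩
    exact hm.2 (show t' ∈ S.σ (i + 1) t from h.2)

/-- The data of the opetope `S*`: the faces of dimension `i` are the nodes of the constellation
tree `S (i + 1) ◁ S i`, with `γ(p) = sup (lvs(p)°)` and `δ(p) = cvr (lvs(p)°)`. -/
noncomputable def dual (S : TreeComplex.{u}) : PreHypergraph.{u} where
  face := S.Star
  γ p := (S.exists_isLUB_lvsCircle p).choose
  δ p := cvr (S.lvsCircle p)

theorem isLUB_dual_γ (S : TreeComplex.{u}) {i : ℕ} (p : S.Star (i + 1)) :
    IsLUB (S.lvsCircle p) (S.dual.γ p) :=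
  (S.exists_isLUB_lvsCircle p).choose_spec

end TreeComplex

/-- The domain of dimension `j` of a face `t`: `δγ⁽ʲ⁺¹⁾(t)` when `j < dim t`, and `{t}` when
`j = dim t`; there is none when `j > dim t`. -/
def domTo {P : PreHypergraph.{u}} (j : ℕ) (t : P.Faces) : Set P.Faces :=
  if t.1 = j then {t} else if j < t.1 then dom (codTo (j + 1) t) else ∅

namespace TreeComplex

variable {S T : TreeComplex.{u}}

/-- The nodes `s` of dimension `j` whose image under the induced map of constellation trees is
below some element of the `j`-dimensional domain of `t`. -/
def below (f : S ⟶ T) (t : T.dual.Faces) (j : ℕ) : Set (S.Star j) :=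
  {s | ∃ t' : T.Star j, (⟨j, t'⟩ : T.dual.Faces) ∈ domTo j t ∧ nodeMap f.app j s ≤ t'}

/-- The description of `f*(t) = s`: the dimension `j` of `s` is the largest one in which
there are nodes below the domain of `t`, and `s` is maximal among those nodes. -/
def IsDualImage (f : S ⟶ T) (t : T.dual.Faces) (s : S.dual.Faces) : Prop :=
  Maximal (fun j => (below f t j).Nonempty) s.1 ∧
    Maximal (fun s' : S.Star s.1 => s' ∈ below f t s.1) s.2

end TreeComplex

/-- The second construction as a contravariant functor: `S` is sent to the positive opetope `S*`,
and `f : S ⟶ T` to the contraction epimorphism `f* : T* ⟶ S*`. -/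
structure TreeToOpetope where
  isOpetope : ∀ S : TreeComplex.{u}, S.dual.IsPositiveOpetope
  map : ∀ {S T : TreeComplex.{u}}, (S ⟶ T) →
    ((⟨T.dual, isOpetope T⟩ : PositiveOpetope.{u}) ⟶ ⟨S.dual, isOpetope S⟩)
  map_eq_iff : ∀ {S T : TreeComplex.{u}} (f : S ⟶ T) (t : T.dual.Faces) (s : S.dual.Faces),
    (map f).toFun t = s ↔ TreeComplex.IsDualImage f t s
  map_id : ∀ S : TreeComplex.{u}, map (𝟙 S) = 𝟙 _
  map_comp : ∀ {S T U : TreeComplex.{u}} (f : S ⟶ T) (g : T ⟶ U),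
    map (f ≫ g) = map g ≫ map f

/-- The functor from the opposite of tree complexes to positive opetopes. -/
noncomputable def TreeToOpetope.functor (B : TreeToOpetope.{u}) :
    TreeComplex.{u}ᵒᵖ ⥤ PositiveOpetope.{u} where
  obj S := ⟨S.unop.dual, B.isOpetope S.unop⟩
  map f := B.map f.unop
  map_id S := B.map_id S.unop
  map_comp f g := B.map_comp g.unop f.unop

/-! ### The components of the natural isomorphisms -/

/-- The map `ε_P : |P**| → |P|`, given by `p• ↦ p` and `p° ↦ γ(p)`. -/
def epsilonFun (A : OpetopeToTree.{u}) (P : PositiveOpetope.{u}) :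
    (⟨P.dual, A.isTreeComplex P⟩ : TreeComplex.{u}).dual.Faces → P.Faces
  | ⟨i, .vertex p⟩ => ⟨i, p.1⟩
  | ⟨i, .circle p⟩ => ⟨i, P.γ p.1⟩

end OpetopeDuality

open OpetopeDuality

namespace OpetopeDuality

/-! ### Finite trees -/

section Tree

variable {T : Type u} [PartialOrder T]

/-! Both constructions rest on one identification: the faces of dimension `k`, ordered by `≤⁺`, form
the constellation tree in dimension `k`.

For a tree complex `S`, each `lvs(p)°` is a convex subtree with top `γ(p)` and cover `δ(p)`. A
covering `x ⋖ t°` is witnessed by the face `t•`, so `<⁺` is the tree order (`dual_upper_iff`). The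
sets `lvs(y)°` for `y ∈ δ(a)` partition `lvs(γ(a))°`, which gives globularity; the other axioms are
facts about covers in trees.

For a positive opetope `P`, globularity refines every `<⁺`-step to a path of steps witnessed by
non-codomains (`path_of_mem_δ`). By pencil linearity a face lies in the domain of at most one
non-codomain and is the codomain of at most one. Hence upward paths are unique and `≤⁺` is a forest,
in fact a tree because the size is at most one. The codomain map identifies the non-codomains of
dimension `k + 1` with the codomains of dimension `k`, so `p• ↦ p`, `p° ↦ γ(p)` is an isomorphism
from the constellation tree to `(P_k, ≤⁺)`, and it respects `γ` and `δ`.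

For morphisms, a contraction epimorphism is in each dimension a partial monotone map, defined where
the dimension does not drop. It has a lower adjoint section (`IsLowerAdjoint`), which is exactly a
map of nodes induced by a tree complex embedding. Conversely an embedding gives a contraction: take
the greatest node whose image is below `t`, or pass to `γ(t)` if there is none. A contraction is
determined by its lower adjoint (`contraction_ext`); this yields functoriality of the second
construction and naturality of `ε`. -/

/-- A minimal common upper bound is a supremum, because any two upper bounds share the lower bound
`a` and are therefore comparable. -/
theorem IsTree.of_common_upper_bound (hf : Finite T) (hub : ∀ a b : T, ∃ c, a ≤ c ∧ b ≤ c)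
    (hc : ∀ a b c : T, c ≤ a → c ≤ b → a ≤ b ∨ b ≤ a) : IsTree T where
  finite := hf
  exists_sup a b := by
    obtain ⟨c₀, h₀⟩ := hub a b
    obtain ⟨c, hc₁, hc₂⟩ := (Set.toFinite {c : T | a ≤ c ∧ b ≤ c}).exists_minimal ⟨c₀, h₀⟩
    refine ⟨c, ?_, ?_⟩
    · rintro x (rfl | rfl)
      exacts [hc₁.1, hc₁.2]
    · intro d hd
      have hda : a ≤ d := hd (by simp)
      have hdb : b ≤ d := hd (by simp)
      rcases hc c d a hc₁.1 hda with h | h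
      exacts [h, hc₂ ⟨hda, hdb⟩ h]
  comparable := hc

theorem IsTree.exists_covBy_le (h : IsTree T) {a b : T} (hab : a < b) : ∃ c, a ⋖ c ∧ c ≤ b := by
  have := h.finite
  exact exists_covBy_le_of_lt hab

theorem IsTree.exists_le_covBy (h : IsTree T) {a b : T} (hab : a < b) : ∃ c, a ≤ c ∧ c ⋖ b := by
  have := h.finite
  exact exists_le_covBy_of_lt hab

theorem IsTree.le_of_covBy_of_lt (h : IsTree T) {a b c : T} (hab : a ⋖ b) (hac : a < c) :
    b ≤ c := by
  rcases h.comparable b c a hab.le hac.le with h' | h'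
  · exact h'
  · rcases h'.eq_or_lt with rfl | h''
    exacts [le_rfl, (hab.2 hac h'').elim]

theorem IsTree.covBy_unique (h : IsTree T) {a b c : T} (hab : a ⋖ b) (hac : a ⋖ c) : b = c :=
  le_antisymm (h.le_of_covBy_of_lt hab hac.lt) (h.le_of_covBy_of_lt hac hab.lt)

variable {X : Set T} {m : T}

theorem lt_of_mem_cvr (hm : IsGreatest X m) {a : T} (ha : a ∈ cvr X) : a < m := by
  obtain ⟨⟨x, hx, hax⟩, -⟩ := ha
  exact hax.lt.trans_le (hm.2 hx)

theorem not_le_of_mem_cvr (hX : X.OrdConnected) (hm : IsGreatest X m) {a x : T} (ha : a ∈ cvr X)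
    (hx : x ∈ X) : ¬ x ≤ a :=
  fun h => ha.2 (hX.out hx hm.1 ⟨h, (lt_of_mem_cvr hm ha).le⟩)

/-- The unique element covering `a` lies in `X`, and `x` lies between it and the top of `X`. -/
theorem IsTree.mem_of_mem_cvr_of_lt (h : IsTree T) (hX : X.OrdConnected) (hm : IsGreatest X m)
    {a x : T} (ha : a ∈ cvr X) (hax : a < x) (hx : x ≤ m) : x ∈ X := by
  obtain ⟨⟨y, hy, hay⟩, -⟩ := ha
  exact hX.out hy hm.1 ⟨h.le_of_covBy_of_lt hay hax, hx⟩

theorem IsTree.eq_of_mem_cvr_of_le (h : IsTree T) (hX : X.OrdConnected) (hm : IsGreatest X m)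
    {a b : T} (ha : a ∈ cvr X) (hb : b ∈ cvr X) (hab : a ≤ b) : a = b := by
  by_contra hne
  exact hb.2 (h.mem_of_mem_cvr_of_lt hX hm ha (lt_of_le_of_ne hab hne) (lt_of_mem_cvr hm hb).le)

/-- Two elements of the cover of a convex subtree with a common lower bound are equal. -/
theorem IsTree.eq_of_mem_cvr (h : IsTree T) (hX : X.OrdConnected) (hm : IsGreatest X m)
    {a b c : T} (ha : a ∈ cvr X) (hb : b ∈ cvr X) (hca : c ≤ a) (hcb : c ≤ b) : a = b := by
  rcases h.comparable a b c hca hcb with h' | h'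
  exacts [h.eq_of_mem_cvr_of_le hX hm ha hb h', (h.eq_of_mem_cvr_of_le hX hm hb ha h').symm]

/-- A maximal non-member between `z` and `m` is covered by something still below `m`, hence by a
member of `X`. -/
theorem IsTree.exists_mem_cvr (h : IsTree T) (hm : IsGreatest X m)
    {z : T} (hz : z ∉ X) (hzm : z ≤ m) : ∃ a ∈ cvr X, z ≤ a := by
  have := h.finite
  obtain ⟨y, hy₁, hy₂⟩ := (Set.toFinite {y : T | z ≤ y ∧ y ≤ m ∧ y ∉ X}).exists_maximal
    ⟨z, le_rfl, hzm, hz⟩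
  have hym : y < m := lt_of_le_of_ne hy₁.2.1 fun h' => hy₁.2.2 (h' ▸ hm.1)
  obtain ⟨c, hyc, hcm⟩ := h.exists_covBy_le hym
  refine ⟨y, ⟨⟨c, ?_, hyc⟩, hy₁.2.2⟩, hy₁.1⟩
  by_contra hc
  exact hyc.lt.not_ge (hy₂ ⟨hy₁.1.trans hyc.le, hcm, hc⟩ hyc.le)

end Tree

/-! ### The opetope of a tree complex -/

namespace TreeComplex

variable (S : TreeComplex.{u}) {i : ℕ}

theorem circle_le_circle {a b : S.T (i + 1)} :
    (Node.circle a : S.Star i) ≤ Node.circle b ↔ a ≤ b := Iff.rfl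

theorem vertex_le_circle {a : S.T i} {b : S.T (i + 1)} :
    (Node.vertex a : S.Star i) ≤ Node.circle b ↔ a ∈ S.σ i b := Iff.rfl

theorem vertex_le_vertex {a b : S.T i} :
    (Node.vertex a : S.Star i) ≤ Node.vertex b ↔ a = b := Iff.rfl

theorem not_circle_le_vertex {a : S.T (i + 1)} {b : S.T i} :
    ¬ (Node.circle a : S.Star i) ≤ Node.vertex b := id

theorem not_lt_vertex {x : S.Star i} {b : S.T i} : ¬ x < Node.vertex b := by
  intro h
  cases x with
  | circle a => exact h.le
  | vertex a =>
    have : a = b := h.le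
    subst this
    exact lt_irrefl _ h

theorem exists_circle_of_lt {x y : S.Star i} (h : x < y) : ∃ t, y = Node.circle t := by
  cases y with
  | circle a => exact ⟨a, rfl⟩
  | vertex a => exact (S.not_lt_vertex h).elim

theorem exists_vertex_le (x : S.Star i) : ∃ t, (Node.vertex t : S.Star i) ≤ x := by
  cases x with
  | vertex a => exact ⟨a, le_rfl⟩
  | circle a =>
    obtain ⟨⟨m, hm⟩, -⟩ := (S.isTreeComplex.constellation i).convex a
    exact ⟨m, hm.1⟩

theorem isTree (i : ℕ) : IsTree (S.T i) := (S.isTreeComplex.constellation i).tree_right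

theorem exists_isTop [Nonempty (S.T i)] : ∃ t : S.T i, IsTop t := by
  have h := S.isTree i
  have := h.finite
  obtain ⟨m, -, hm⟩ := (Set.toFinite (Set.univ : Set (S.T i))).exists_maximal Set.univ_nonempty
  refine ⟨m, fun a => ?_⟩
  obtain ⟨c, hc⟩ := h.exists_sup m a
  exact (hc.1 (by simp)).trans (hm trivial (hc.1 (by simp)))

/-- The values of `σ` are nonempty, so an empty level forces all later levels to be empty; thus `i`
is the last nonempty level or beyond it. -/
theorem subsingleton_of_isEmpty (h : IsEmpty (S.T (i + 1))) : Subsingleton (S.T i) := by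
  obtain ⟨n, hn, hm⟩ := S.isTreeComplex.top
  rcases lt_trichotomy i n with h' | rfl | h'
  · exfalso
    have : ∀ k, IsEmpty (S.T (i + 1 + k)) := by
      intro k
      induction k with
      | zero => exact h
      | succ k ih =>
        refine ⟨fun a => ?_⟩
        obtain ⟨⟨m, -⟩, -⟩ := (S.isTreeComplex.constellation (i + 1 + k)).convex a
        exact ih.false m
    obtain ⟨k, rfl⟩ : ∃ k, n = i + 1 + k := ⟨n - (i + 1), by omega⟩
    have := this k
    simp at hn
  · exact (Nat.card_eq_one_iff_unique.1 hn).1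
  · have := hm i h'
    infer_instance

theorem star_common_upper_bound (x y : S.Star i) : ∃ z, x ≤ z ∧ y ≤ z := by
  rcases isEmpty_or_nonempty (S.T (i + 1)) with h | h
  · have := S.subsingleton_of_isEmpty h
    cases x with
    | circle a => exact h.elim a
    | vertex a =>
      cases y with
      | circle b => exact h.elim b
      | vertex b => exact ⟨_, le_rfl, (Subsingleton.elim b a).le.antisymm (Subsingleton.elim a b).le⟩
  · obtain ⟨t, ht⟩ := S.exists_isTop (i := i + 1)
    have key : ∀ x : S.Star i, x ≤ Node.circle t := by
      rintro (a | a)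
      · exact ht a
      · have := (S.isTreeComplex.constellation i).map_top t ht
        exact (S.vertex_le_circle).2 (this ▸ trivial)
    exact ⟨_, key x, key y⟩

theorem isTree_star (i : ℕ) : IsTree (S.Star i) := by
  refine IsTree.of_common_upper_bound ?_ S.star_common_upper_bound ?_
  · have := (S.isTree i).finite
    have := (S.isTree (i + 1)).finite
    refine Finite.of_injective (β := S.T (i + 1) ⊕ S.T i)
      (fun x => match x with | .circle a => Sum.inl a | .vertex b => Sum.inr b) ?_
    rintro (a | a) (b | b) h <;> simp_all
  · rintro (a | a) (b | b) (c | c) hca hcb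
    · exact (S.isTree (i + 1)).comparable a b c hca hcb
    · exact (S.isTreeComplex.constellation i).comparable a b ⟨c, hca, hcb⟩
    · exact hcb.elim
    · exact Or.inr ((S.vertex_le_vertex.1 hcb) ▸ hca)
    · exact hca.elim
    · exact Or.inl ((S.vertex_le_vertex.1 hca) ▸ hcb)
    · exact hca.elim
    · exact Or.inl (((S.vertex_le_vertex.1 hca).symm.trans (S.vertex_le_vertex.1 hcb)) ▸ le_rfl)

theorem circle_mem_lvsCircle {p : S.Star (i + 1)} {t : S.T (i + 1)} :
    (Node.circle t : S.Star i) ∈ S.lvsCircle p ↔ (Node.vertex t : S.Star (i + 1)) ≤ p := by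
  constructor
  · rintro ⟨t', h, h'⟩
    cases h'
    exact h.2
  · exact fun h => ⟨t, ⟨S.isLeaf_vertex t, h⟩, rfl⟩

theorem vertex_notMem_lvsCircle {p : S.Star (i + 1)} {t : S.T i} :
    (Node.vertex t : S.Star i) ∉ S.lvsCircle p := by
  rintro ⟨t', -, h⟩
  cases h

theorem lvsCircle_mono {p q : S.Star (i + 1)} (h : p ≤ q) : S.lvsCircle p ⊆ S.lvsCircle q := by
  rintro _ ⟨t, ht, rfl⟩
  exact S.circle_mem_lvsCircle.2 (ht.2.trans h)

theorem le_or_le_of_mem_lvsCircle {p q : S.Star (i + 1)} {x : S.Star i} (hp : x ∈ S.lvsCircle p)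
    (hq : x ∈ S.lvsCircle q) : p ≤ q ∨ q ≤ p := by
  obtain ⟨t, ht, rfl⟩ := hp
  exact (S.isTree_star _).comparable _ _ _ ht.2 (S.circle_mem_lvsCircle.1 hq)

/-- The set is a singleton when `p` is a vertex, and the convex subtree `σ t` when `p` is the circle
of `t`. -/
theorem lvsCircle_ordConnected (p : S.Star (i + 1)) : (S.lvsCircle p).OrdConnected := by
  refine ⟨fun x hx z hz y hy => ?_⟩
  obtain ⟨a, ha, rfl⟩ := hx
  obtain ⟨c, hc, rfl⟩ := hz
  cases y with
  | vertex b => exact (S.not_circle_le_vertex hy.1).elim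
  | circle b =>
    rw [circle_mem_lvsCircle]
    cases p with
    | vertex t =>
      have h₁ : a = t := ha.2
      have h₂ : c = t := hc.2
      subst h₁
      subst h₂
      exact (le_antisymm (α := S.T (i + 1)) hy.2 hy.1 : b = c)
    | circle t =>
      exact ((S.isTreeComplex.constellation (i + 1)).convex t).2.out ha.2 hc.2 ⟨hy.1, hy.2⟩

/-- The supremum defining `γ(p)` is attained; later arguments use `γ(p)` as the top of the convex
subtree `lvs(p)°`. -/
theorem isGreatest_dual_γ (p : S.Star (i + 1)) : IsGreatest (S.lvsCircle p) (S.dual.γ p) := by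
  have key : ∃ m, IsGreatest (S.lvsCircle p) m := by
    cases p with
    | vertex t =>
      refine ⟨Node.circle t, S.circle_mem_lvsCircle.2 le_rfl, ?_⟩
      rintro _ ⟨t', h, rfl⟩
      exact (S.vertex_le_vertex.1 h.2).le
    | circle t =>
      obtain ⟨m, hm⟩ := ((S.isTreeComplex.constellation (i + 1)).convex t).1
      refine ⟨Node.circle m, S.circle_mem_lvsCircle.2 hm.1, ?_⟩
      rintro _ ⟨t', h, rfl⟩
      exact hm.2 h.2
  obtain ⟨m, hm⟩ := key
  rwa [(S.isLUB_dual_γ p).unique hm.isLUB]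

theorem dual_γ_vertex (t : S.T (i + 1)) :
    S.dual.γ (Node.vertex t : S.Star (i + 1)) = (Node.circle t : S.Star i) := by
  obtain ⟨t', ht, h⟩ := (S.isGreatest_dual_γ (Node.vertex t : S.Star (i + 1))).1
  rw [h, S.vertex_le_vertex.1 ht.2]

theorem dual_γ_mono {p q : S.Star (i + 1)} (h : p ≤ q) :
    @LE.le (S.Star i) _ (S.dual.γ p) (S.dual.γ q) :=
  (S.isGreatest_dual_γ q).2 (S.lvsCircle_mono h (S.isGreatest_dual_γ p).1)

theorem mem_dual_δ {p : S.Star (i + 1)} {x : S.Star i} :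
    x ∈ S.dual.δ p ↔ x ∈ cvr (S.lvsCircle p) := Iff.rfl

theorem mem_dual_δ_vertex {t : S.T (i + 1)} {x : S.Star i} :
    x ∈ S.dual.δ (Node.vertex t : S.Star (i + 1)) ↔ x ⋖ Node.circle t := by
  rw [mem_dual_δ]
  constructor
  · rintro ⟨⟨_, ⟨t', ht', rfl⟩, h⟩, -⟩
    rwa [S.vertex_le_vertex.1 ht'.2] at h
  · refine fun h => ⟨⟨_, S.circle_mem_lvsCircle.2 le_rfl, h⟩, ?_⟩
    rintro ⟨t', ht', rfl⟩
    rw [S.vertex_le_vertex.1 ht'.2] at h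
    exact lt_irrefl _ h.lt

/-- The domain of a face is an antichain. -/
theorem eq_of_mem_dual_δ {p : S.Star (i + 1)} {x y z : S.Star i} (hx : x ∈ S.dual.δ p)
    (hy : y ∈ S.dual.δ p) (hzx : z ≤ x) (hzy : z ≤ y) : x = y :=
  (S.isTree_star i).eq_of_mem_cvr (S.lvsCircle_ordConnected p) (S.isGreatest_dual_γ p) hx hy hzx hzy

theorem lt_γ_of_mem_dual_δ {p : S.Star (i + 1)} {x : S.Star i} (hx : x ∈ S.dual.δ p) :
    @LT.lt (S.Star i) _ x (S.dual.γ p) :=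
  lt_of_mem_cvr (S.isGreatest_dual_γ p) hx

theorem exists_mem_dual_δ {p : S.Star (i + 1)} {x : S.Star i} (hx : x ∉ S.lvsCircle p)
    (h : @LE.le (S.Star i) _ x (S.dual.γ p)) : ∃ y : S.Star i, y ∈ S.dual.δ p ∧ x ≤ y :=
  (S.isTree_star i).exists_mem_cvr (S.isGreatest_dual_γ p) hx h

/-- The upper order of the opetope is the order of the constellation tree. -/
theorem dual_upper_iff {x y : S.Star i} : S.dual.upper i x y ↔ x < y := by
  constructor
  · intro h
    have step : ∀ a b : S.Star i, S.dual.upperStep i a b → a < b := by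
      rintro a _ ⟨α, h, rfl⟩
      exact S.lt_γ_of_mem_dual_δ h
    induction h with
    | single h => exact step _ _ h
    | tail _ h ih => exact lt_trans (α := S.Star i) ih (step _ _ h)
  -- A chain of coverings suffices: anything strictly above another node is a circle `t°`, and `t•`
  -- has the sons of `t°` as domain and `t°` as codomain.
  · have := (S.isTree_star i).finite
    induction x using WellFoundedGT.induction with
    | ind x ih =>
      intro h
      obtain ⟨c, hxc, hcy⟩ := (S.isTree_star i).exists_covBy_le h
      obtain ⟨t, rfl⟩ := S.exists_circle_of_lt hxc.lt
      have hs : S.dual.upperStep i x (Node.circle t : S.Star i) :=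
        ⟨(Node.vertex t : S.Star (i + 1)), S.mem_dual_δ_vertex.2 hxc, S.dual_γ_vertex t⟩
      rcases hcy.eq_or_lt with rfl | hcy
      · exact .single hs
      · exact .head hs (ih _ hxc.lt hcy)

theorem dual_upperPerp_or_eq {x y : S.Star i} (h : x ≤ y ∨ y ≤ x) :
    x = y ∨ S.dual.upperPerp i x y := by
  rcases h with h | h <;> rcases h.eq_or_lt with h | h
  · exact .inl h
  · exact .inr (.inl (S.dual_upper_iff.2 h))
  · exact .inl h.symm
  · exact .inr (.inr (S.dual_upper_iff.2 h))

theorem lvsCircle_subset_of_mem_dual_δ {a : S.Star (i + 2)} {y : S.Star (i + 1)}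
    (hy : y ∈ S.dual.δ a) : S.lvsCircle y ⊆ S.lvsCircle (S.dual.γ a) :=
  S.lvsCircle_mono (S.lt_γ_of_mem_dual_δ hy).le

/-- With `lvsCircle_subset_of_mem_dual_δ` and `eq_of_mem_lvsCircle` this says that the sets
`lvs(y)°`, `y ∈ δ(a)`, partition `lvs(γ(a))°`: a vertex below `γ(a)` is never in `lvs(a)°`, so it
lies below an element of the cover. -/
theorem exists_mem_lvsCircle_of_mem {a : S.Star (i + 2)} {x : S.Star i}
    (hx : x ∈ S.lvsCircle (S.dual.γ a)) : ∃ y : S.Star (i + 1), y ∈ S.dual.δ a ∧ x ∈ S.lvsCircle y := by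
  obtain ⟨t, ht, rfl⟩ := hx
  obtain ⟨y, hy, hty⟩ := S.exists_mem_dual_δ S.vertex_notMem_lvsCircle ht.2
  exact ⟨y, hy, S.circle_mem_lvsCircle.2 hty⟩

theorem eq_of_mem_lvsCircle {a : S.Star (i + 2)} {y y' : S.Star (i + 1)} {x : S.Star i}
    (hy : y ∈ S.dual.δ a) (hy' : y' ∈ S.dual.δ a) (hx : x ∈ S.lvsCircle y)
    (hx' : x ∈ S.lvsCircle y') : y = y' := by
  obtain ⟨t, ht, rfl⟩ := hx
  exact S.eq_of_mem_dual_δ hy hy' ht.2 (S.circle_mem_lvsCircle.1 hx')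

theorem dual_glob_γ (a : S.dual.face (i + 2)) :
    {S.dual.γ (S.dual.γ a)} = S.dual.γδ a \ S.dual.δδ a := by
  apply Set.Subset.antisymm
  · rintro _ rfl
    refine ⟨?_, ?_⟩
    · obtain ⟨y, hy, h⟩ := S.exists_mem_lvsCircle_of_mem (S.isGreatest_dual_γ (S.dual.γ a)).1
      exact ⟨y, hy, le_antisymm (α := S.Star i) (S.dual_γ_mono (S.lt_γ_of_mem_dual_δ hy).le)
        ((S.isGreatest_dual_γ y).2 h)⟩
    · rintro ⟨y, hy, h⟩
      exact ((S.lt_γ_of_mem_dual_δ h).trans_le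
        (S.dual_γ_mono (S.lt_γ_of_mem_dual_δ hy).le)).false
  · rintro x ⟨⟨y, hy, rfl⟩, hn⟩
    by_contra hne
    have hlt := lt_of_le_of_ne (S.dual_γ_mono (S.lt_γ_of_mem_dual_δ hy).le) hne
    -- The element covering `γ(y)` belongs to another block `lvs(y')°`, which puts `γ(y)` into
    -- `δ(y')`.
    obtain ⟨c, hxc, hc⟩ := (S.isTree_star i).exists_covBy_le hlt
    have hγ := S.lvsCircle_subset_of_mem_dual_δ hy (S.isGreatest_dual_γ y).1
    have hcX : c ∈ S.lvsCircle (S.dual.γ a) :=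
      (S.lvsCircle_ordConnected _).out hγ (S.isGreatest_dual_γ _).1 ⟨hxc.le, hc⟩
    obtain ⟨y', hy', hcy'⟩ := S.exists_mem_lvsCircle_of_mem hcX
    refine hn ⟨y', hy', ⟨c, hcy', hxc⟩, fun h => ?_⟩
    have := S.eq_of_mem_lvsCircle hy hy' (S.isGreatest_dual_γ y).1 h
    subst this
    exact hxc.lt.not_ge ((S.isGreatest_dual_γ y).2 hcy')

theorem dual_glob_δ (a : S.dual.face (i + 2)) :
    S.dual.δ (S.dual.γ a) = S.dual.δδ a \ S.dual.γδ a := by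
  apply Set.Subset.antisymm
  · rintro x ⟨⟨c, hc, hxc⟩, hx⟩
    obtain ⟨y, hy, hcy⟩ := S.exists_mem_lvsCircle_of_mem hc
    refine ⟨⟨y, hy, ⟨c, hcy, hxc⟩, fun h => hx (S.lvsCircle_subset_of_mem_dual_δ hy h)⟩, ?_⟩
    rintro ⟨y', hy', rfl⟩
    exact hx (S.lvsCircle_subset_of_mem_dual_δ hy' (S.isGreatest_dual_γ y').1)
  · rintro x ⟨⟨y, hy, ⟨c, hcy, hxc⟩, hxy⟩, hn⟩
    refine ⟨⟨c, S.lvsCircle_subset_of_mem_dual_δ hy hcy, hxc⟩, fun hx => ?_⟩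
    -- Otherwise `x` is a non-top element of some block `lvs(y')°`. That block then also contains
    -- `c`, the element covering `x`, so `y' = y`, contradicting `x ∉ lvs(y)°`.
    obtain ⟨y', hy', hxy'⟩ := S.exists_mem_lvsCircle_of_mem hx
    have hne : x ≠ S.dual.γ y' := fun h => hn ⟨y', hy', h.symm⟩
    have hlt := lt_of_le_of_ne ((S.isGreatest_dual_γ y').2 hxy') hne
    have hcy' : c ∈ S.lvsCircle y' := (S.lvsCircle_ordConnected _).out hxy'
      (S.isGreatest_dual_γ _).1 ⟨hxc.le, (S.isTree_star i).le_of_covBy_of_lt hxc hlt⟩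
    have := S.eq_of_mem_lvsCircle hy hy' hcy hcy'
    subst this
    exact hxy hxy'

theorem dual_δ_nonempty (a : S.Star (i + 1)) : (S.dual.δ a).Nonempty := by
  obtain ⟨t, ht, h⟩ := (S.isGreatest_dual_γ a).1
  obtain ⟨v, hv⟩ := S.exists_vertex_le (Node.circle t : S.Star i)
  obtain ⟨y, hy, -⟩ := S.exists_mem_dual_δ (p := a) S.vertex_notMem_lvsCircle (h ▸ hv)
  exact ⟨y, hy⟩

theorem star_zero_total (x y : S.Star 0) : x ≤ y ∨ y ≤ x := by
  have hs := (Nat.card_eq_one_iff_unique.1 S.isTreeComplex.bottom).1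
  obtain ⟨v, hv⟩ := S.exists_vertex_le x
  obtain ⟨w, hw⟩ := S.exists_vertex_le y
  rw [Subsingleton.elim w v] at hw
  exact (S.isTree_star 0).comparable x y _ hv hw

theorem dual_lower_le_δ {a b : S.Star (i + 1)} (h : S.dual.lower (i + 1) a b) :
    ∃ y : S.Star i, y ∈ S.dual.δ b ∧ @LE.le (S.Star i) _ (S.dual.γ a) y := by
  induction h with
  | single h => exact ⟨_, h, le_rfl⟩
  | tail _ h ih =>
    obtain ⟨y, hy, hay⟩ := ih
    exact ⟨_, h, hay.trans (S.lt_γ_of_mem_dual_δ hy).le⟩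

/-- If `a < b`, then `γ(a)` belongs to `lvs(b)°` and cannot lie below its cover, while `γ(b) ≤ y <
γ(a) ≤ γ(b)` is absurd for `y ∈ δ(a)`. -/
theorem dual_disjoint {a b : S.Star (i + 1)} (hab : a < b) :
    ¬ S.dual.lowerPerp (i + 1) a b := by
  rintro (h | h)
  · obtain ⟨y, hy, h⟩ := S.dual_lower_le_δ h
    exact not_le_of_mem_cvr (S.lvsCircle_ordConnected b) (S.isGreatest_dual_γ b) hy
      (S.lvsCircle_mono hab.le (S.isGreatest_dual_γ a).1) h
  · obtain ⟨y, hy, h⟩ := S.dual_lower_le_δ h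
    exact ((h.trans_lt (S.lt_γ_of_mem_dual_δ hy)).trans_le (S.dual_γ_mono hab.le)).false

/-- The dual of a tree complex is a positive opetope. -/
theorem isPositiveOpetope_dual : S.dual.IsPositiveOpetope where
  finite k := (S.isTree_star k).finite
  bounded := by
    obtain ⟨n, -, hn⟩ := S.isTreeComplex.top
    refine ⟨n, fun k hk => ⟨fun x => ?_⟩⟩
    cases x with
    | circle a => exact (hn (k + 1) (by omega)).false a
    | vertex a => exact (hn k hk).false a
  δ_nonempty a := S.dual_δ_nonempty a
  δ_zero a := by
    obtain ⟨x, hx⟩ := S.dual_δ_nonempty a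
    refine ⟨x, Set.eq_singleton_iff_unique_mem.2 ⟨hx, fun y hy => ?_⟩⟩
    rcases S.star_zero_total x y with h | h
    · exact S.eq_of_mem_dual_δ hy hx h le_rfl
    · exact S.eq_of_mem_dual_δ hy hx le_rfl h
  nonempty := by
    obtain ⟨-, ⟨t⟩⟩ := Nat.card_eq_one_iff_unique.1 S.isTreeComplex.bottom
    exact ⟨(Node.vertex t : S.Star 0)⟩
  glob_γ := S.dual_glob_γ
  glob_δ := S.dual_glob_δ
  strict k a h := lt_irrefl (α := S.Star k) a (S.dual_upper_iff.1 h)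
  linear a b := S.dual_upperPerp_or_eq (S.star_zero_total a b)
  disjoint k a b := by
    rintro ⟨hl, h | h⟩
    · exact S.dual_disjoint (S.dual_upper_iff.1 h) hl
    · exact S.dual_disjoint (S.dual_upper_iff.1 h) hl.symm
  pencil_γ {k} a b h := by
    refine S.dual_upperPerp_or_eq (S.le_or_le_of_mem_lvsCircle (S.isGreatest_dual_γ a).1 ?_)
    rw [h]
    exact (S.isGreatest_dual_γ b).1
  pencil_δ {k} x a b ha hb := by
    obtain ⟨⟨c, hc, hxc⟩, -⟩ := ha
    obtain ⟨⟨d, hd, hxd⟩, -⟩ := hb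
    -- The only node covering `x` lies in both leaf sets.
    rw [← (S.isTree_star k).covBy_unique hxc hxd] at hd
    exact S.dual_upperPerp_or_eq (S.le_or_le_of_mem_lvsCircle hc hd)
  size_le_one k := by
    have := (S.isTree_star k).finite
    refine (Set.ncard_le_one (Set.toFinite (α := S.Star k) _)).2 fun a ha b hb => ?_
    -- A face in no domain is maximal in the tree, and common upper bounds leave room for only one.
    have key : ∀ x y : S.Star k, (∀ α : S.Star (k + 1), x ∉ S.dual.δ α) → x ≤ y → x = y := by
      intro x y hx hxy
      by_contra hne
      obtain ⟨_, ⟨α, h, -⟩, -⟩ :=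
        Relation.TransGen.head'_iff.1 (S.dual_upper_iff.2 (lt_of_le_of_ne hxy hne))
      exact hx α h
    obtain ⟨c, hac, hbc⟩ := S.star_common_upper_bound a b
    exact (key a c ha hac).trans (key b c hb hbc).symm

end TreeComplex

open Relation

namespace PositiveOpetope

variable (P : PositiveOpetope.{u}) {k : ℕ}

/-! ### The upper order of a positive opetope -/

/-- The reflexive upper order. -/
def ule (k : ℕ) : P.face k → P.face k → Prop := ReflTransGen (P.upperStep k)

/-- One step of the upper order witnessed by a face in `A`. -/
def stepIn (A : Set (P.face (k + 1))) (a b : P.face k) : Prop := ∃ s ∈ A, a ∈ P.δ s ∧ P.γ s = b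

/-- The faces which are not codomains. -/
def verts (k : ℕ) : Set (P.face k) := (Set.range (P.γ (k := k)))ᶜ

variable {P}

theorem stepIn.mono {A B : Set (P.face (k + 1))} (h : A ⊆ B) {a b : P.face k}
    (hab : P.stepIn A a b) : P.stepIn B a b := by
  obtain ⟨s, hs, h'⟩ := hab
  exact ⟨s, h hs, h'⟩

theorem stepIn.upperStep {A : Set (P.face (k + 1))} {a b : P.face k}
    (hab : P.stepIn A a b) : P.upperStep k a b := by
  obtain ⟨s, -, h'⟩ := hab
  exact ⟨s, h'⟩

theorem ule_iff {a b : P.face k} : P.ule k a b ↔ a = b ∨ P.upper k a b := by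
  rw [ule, PreHypergraph.upper, reflTransGen_iff_eq_or_transGen, eq_comm]

theorem ule_of_upper {a b : P.face k} (h : P.upper k a b) : P.ule k a b := ule_iff.2 (.inr h)

theorem not_ule_of_upper {a b : P.face k} (h : P.upper k a b) : ¬ P.ule k b a :=
  fun h' => P.isOpetope.strict k a (h.trans_left h')

theorem ule_of_path {A : Set (P.face (k + 1))} {a b : P.face k}
    (h : ReflTransGen (P.stepIn A) a b) : P.ule k a b :=
  ReflTransGen.mono (fun _ _ h => h.upperStep) _ _ h

theorem ule_antisymm {a b : P.face k} (h : P.ule k a b) (h' : P.ule k b a) : a = b := by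
  rcases ule_iff.1 h with h | h
  exacts [h, (not_ule_of_upper h h').elim]

theorem wellFounded_upper : WellFounded (P.upper k) := by
  have := P.isOpetope.finite k
  have : IsTrans _ (P.upper k) := ⟨fun _ _ _ h h' => h.trans h'⟩
  have : Std.Irrefl (P.upper k) := ⟨P.isOpetope.strict k⟩
  exact Finite.wellFounded_of_trans_of_irrefl _

theorem wellFounded_lower : WellFounded (P.lower k) := by
  have := P.isOpetope.finite k
  have : IsTrans _ (P.lower k) := ⟨fun _ _ _ h h' => h.trans h'⟩
  have : Std.Irrefl (P.lower k) := ⟨P.lower_irrefl⟩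
  exact Finite.wellFounded_of_trans_of_irrefl _

theorem wellFounded_lower_swap : WellFounded (Function.swap (P.lower k)) := by
  have := P.isOpetope.finite k
  have : IsTrans _ (Function.swap (P.lower k)) := ⟨fun _ _ _ h h' => h'.trans h⟩
  have : Std.Irrefl (Function.swap (P.lower k)) := ⟨P.lower_irrefl⟩
  exact Finite.wellFounded_of_trans_of_irrefl _

/-- By globularity `γ(y)` is either `γγ(β)` or in the domain of a further element of `δ(β)`,
strictly later in `<⁻`; this terminates. -/
theorem path_to_γγ {β : P.face (k + 2)} (y : P.face (k + 1)) (hy : y ∈ P.δ β) :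
    ReflTransGen (P.stepIn (P.δ β)) (P.γ y) (P.γ (P.γ β)) := by
  induction y using wellFounded_lower_swap.induction with
  | h y ih =>
    by_cases h : P.γ y = P.γ (P.γ β)
    · rw [h]
    · have : P.γ y ∈ P.δδ β := by
        by_contra hn
        have h' : P.γ y ∈ P.γδ β \ P.δδ β := ⟨⟨y, hy, rfl⟩, hn⟩
        rw [← P.isOpetope.glob_γ] at h'
        exact h h'
      obtain ⟨y', hy', h'⟩ := this
      exact .head ⟨y', hy', h', rfl⟩ (ih y' (.single h') hy')

/-- The mirror image of `path_to_γγ`: descend along `<⁻` until reaching a face outside `γδ(β)`. -/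
theorem path_from_δγ {β : P.face (k + 2)} (y : P.face (k + 1)) (hy : y ∈ P.δ β) (x : P.face k)
    (hx : x ∈ P.δ y) : ∃ z ∈ P.δ (P.γ β), ReflTransGen (P.stepIn (P.δ β)) z x := by
  induction y using wellFounded_lower.induction generalizing x with
  | h y ih =>
    by_cases h : x ∈ P.γδ β
    · obtain ⟨y', hy', rfl⟩ := h
      obtain ⟨x', hx'⟩ := P.isOpetope.δ_nonempty y'
      obtain ⟨z, hz, hzx⟩ := ih y' (.single hx) hy' x' hx'
      exact ⟨z, hz, hzx.tail ⟨y', hy', hx', rfl⟩⟩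
    · refine ⟨x, ?_, .refl⟩
      rw [P.isOpetope.glob_δ]
      exact ⟨⟨y, hy, hx⟩, h⟩

/-- The upper order is generated by the faces which are not codomains. -/
theorem path_of_mem_δ (α : P.face (k + 1)) (a : P.face k) (ha : a ∈ P.δ α) :
    TransGen (P.stepIn {s | s ∈ P.verts (k + 1) ∧ P.ule (k + 1) s α}) a (P.γ α) := by
  induction α using wellFounded_upper.induction generalizing a with
  | h α ih =>
    by_cases h : α ∈ Set.range P.γ
    · obtain ⟨β, rfl⟩ := h
      have h' := ha
      rw [P.isOpetope.glob_δ] at h'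
      obtain ⟨⟨y, hy, hay⟩, -⟩ := h'
      -- A step witnessed by `γ(β)` is replaced by a path of steps witnessed by elements of `δ(β)`.
      -- These are `<⁺`-below `γ(β)`, so induction refines each of them.
      have key : ∀ y ∈ P.δ β, ∀ a ∈ P.δ y, TransGen
          (P.stepIn {s | s ∈ P.verts (k + 1) ∧ P.ule (k + 1) s (P.γ β)}) a (P.γ y) := by
        intro y hy a ha
        have hup : P.upperStep (k + 1) y (P.γ β) := ⟨β, hy, rfl⟩
        refine TransGen.mono ?_ _ _ (ih y (.single hup) a ha)
        rintro _ _ ⟨s, hs, h⟩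
        exact ⟨s, ⟨hs.1, hs.2.tail hup⟩, h⟩
      refine (key y hy a hay).trans_left (reflTransGen_closed ?_ _ _ (path_to_γγ y hy))
      rintro c _ ⟨s, hs, hc, rfl⟩
      exact (key s hs c hc).to_reflTransGen
    · exact .single ⟨α, ⟨h, .refl⟩, ha, rfl⟩

theorem γ_ule_γ {s α : P.face (k + 1)} (h : P.ule (k + 1) s α) : P.ule k (P.γ s) (P.γ α) := by
  induction h with
  | refl => exact .refl
  | tail _ h ih =>
    obtain ⟨β, hy, rfl⟩ := h
    exact ih.trans (ule_of_path (path_to_γγ _ hy))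

theorem exists_δ_ule {s α : P.face (k + 1)} (h : P.ule (k + 1) s α) {x : P.face k}
    (hx : x ∈ P.δ s) : ∃ y ∈ P.δ α, P.ule k y x := by
  induction h with
  | refl => exact ⟨x, hx, .refl⟩
  | tail _ h ih =>
    obtain ⟨β, hy, rfl⟩ := h
    obtain ⟨y, hy', hyx⟩ := ih
    obtain ⟨z, hz, hzy⟩ := path_from_δγ _ hy y hy'
    exact ⟨z, hz, .trans (ule_of_path hzy) hyx⟩

theorem notMem_verts_of_upper {a b : P.face k} (h : P.upper k a b) : b ∉ P.verts k := by
  obtain ⟨c, -, α, -, h⟩ := TransGen.tail'_iff.1 h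
  exact fun hb => hb ⟨α, h⟩

/-- Non-codomains are minimal for `<⁺`. This turns pencil linearity into the uniqueness statements
`eq_of_mem_δ` and `eq_of_γ_eq`. -/
theorem eq_of_upperPerp {s s' : P.face k} (hs : s ∈ P.verts k) (hs' : s' ∈ P.verts k)
    (h : s = s' ∨ P.upperPerp k s s') : s = s' := by
  rcases h with h | h | h
  · exact h
  · exact (notMem_verts_of_upper h hs').elim
  · exact (notMem_verts_of_upper h hs).elim

theorem eq_of_mem_δ {s s' : P.face (k + 1)} (hs : s ∈ P.verts (k + 1))
    (hs' : s' ∈ P.verts (k + 1)) {x : P.face k} (h : x ∈ P.δ s) (h' : x ∈ P.δ s') : s = s' :=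
  eq_of_upperPerp hs hs' (P.isOpetope.pencil_δ x s s' h h')

theorem eq_of_γ_eq {s s' : P.face (k + 1)} (hs : s ∈ P.verts (k + 1))
    (hs' : s' ∈ P.verts (k + 1)) (h : P.γ s = P.γ s') : s = s' :=
  eq_of_upperPerp hs hs' (P.isOpetope.pencil_γ s s' h)

theorem path_of_upper {a b : P.face k} (h : P.upper k a b) :
    TransGen (P.stepIn (P.verts (k + 1))) a b := by
  refine TransGen.closed ?_ _ _ h
  rintro a _ ⟨α, ha, rfl⟩
  exact TransGen.mono (fun _ _ h => h.mono fun s hs => hs.1) _ _ (path_of_mem_δ α a ha)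

/-- The last step of a refined path from `δ(α)` to `γ(α)` is witnessed by such an `s`. -/
theorem exists_verts_γ_eq (α : P.face (k + 1)) :
    ∃ s ∈ P.verts (k + 1), P.ule (k + 1) s α ∧ P.γ s = P.γ α := by
  obtain ⟨a, ha⟩ := P.isOpetope.δ_nonempty α
  obtain ⟨c, -, s, hs, -, h⟩ := TransGen.tail'_iff.1 (path_of_mem_δ α a ha)
  exact ⟨s, hs.1, hs.2, h⟩

/-- The step through `s` is the only non-codomain step out of `a`, so every refined path from `a`
starts with it. -/
theorem γ_ule_of_upper {s : P.face (k + 1)} (hs : s ∈ P.verts (k + 1)) {a b : P.face k}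
    (ha : a ∈ P.δ s) (h : P.upper k a b) : P.ule k (P.γ s) b := by
  obtain ⟨c, ⟨s', hs', ha', rfl⟩, hc⟩ := TransGen.head'_iff.1 (path_of_upper h)
  rw [eq_of_mem_δ hs hs' ha ha']
  exact ule_of_path hc

theorem ule_comparable {a b c : P.face k} (ha : P.ule k c a) (hb : P.ule k c b) :
    P.ule k a b ∨ P.ule k b a := by
  have ha' : ReflTransGen (P.stepIn (P.verts (k + 1))) c a := by
    rcases ule_iff.1 ha with rfl | h
    exacts [.refl, (path_of_upper h).to_reflTransGen]
  clear ha
  induction ha' using ReflTransGen.head_induction_on with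
  | refl => exact .inl hb
  | head h h' ih =>
    rcases ule_iff.1 hb with rfl | hb
    · exact .inr (.head h.upperStep (ule_of_path h'))
    · obtain ⟨s, hs, hc, rfl⟩ := h
      exact ih (γ_ule_of_upper hs hc hb)

/-- Climbing from any face ends at a face in no domain, and by the size condition there is only one.
-/
theorem ule_common_upper_bound (a b : P.face k) : ∃ c, P.ule k a c ∧ P.ule k b c := by
  have hf := P.isOpetope.finite k
  have key : ∀ a : P.face k, ∃ c, P.ule k a c ∧ ∀ α, c ∉ P.δ α := by
    have : IsTrans _ (Function.swap (P.upper k)) := ⟨fun _ _ _ h h' => h'.trans h⟩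
    have : Std.Irrefl (Function.swap (P.upper k)) := ⟨P.isOpetope.strict k⟩
    intro a
    induction a using
      (Finite.wellFounded_of_trans_of_irrefl (Function.swap (P.upper k))).induction with
    | h a ih =>
      by_cases h : ∃ α, a ∈ P.δ α
      · obtain ⟨α, h⟩ := h
        have hs : P.upperStep k a (P.γ α) := ⟨α, h, rfl⟩
        obtain ⟨c, hc, hc'⟩ := ih (P.γ α) (.single hs)
        exact ⟨c, .head hs hc, hc'⟩
      · exact ⟨a, .refl, fun α hα => h ⟨α, hα⟩⟩
  obtain ⟨c, hac, hc⟩ := key a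
  obtain ⟨d, hbd, hd⟩ := key b
  have := (Set.ncard_le_one (Set.toFinite _)).1 (P.isOpetope.size_le_one k) c hc d hd
  subst this
  exact ⟨c, hac, hbd⟩

theorem exists_verts_ule (a : P.face k) : ∃ v ∈ P.verts k, P.ule k v a := by
  induction a using wellFounded_upper.induction with
  | h a ih =>
    by_cases h : a ∈ P.verts k
    · exact ⟨a, h, .refl⟩
    · obtain ⟨α, rfl⟩ := not_not.1 h
      obtain ⟨x, hx⟩ := P.isOpetope.δ_nonempty α
      have hs : P.upperStep k x (P.γ α) := ⟨α, hx, rfl⟩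
      obtain ⟨v, hv, hvx⟩ := ih x (.single hs)
      exact ⟨v, hv, hvx.tail hs⟩

theorem ule_iff_upper_of_verts {s : P.face k} (hs : s ∈ P.verts k) {α : P.face (k + 1)} :
    P.ule k s (P.γ α) ↔ P.upper k s (P.γ α) := by
  refine ⟨fun h => ?_, ule_of_upper⟩
  rcases ule_iff.1 h with h | h
  · exact (hs ⟨α, h.symm⟩).elim
  · exact h

/-- Upward paths are unique, so the path from `y` to `z` passes through every face above `y` and
below `z`. -/
theorem exists_γ_eq_of_path {V : Set (P.face (k + 1))} (hV : V ⊆ P.verts (k + 1))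
    {x y z : P.face k} (h : TransGen (P.stepIn V) y z) (hyx : P.upper k y x)
    (hxz : P.ule k x z) : ∃ s ∈ V, P.γ s = x := by
  induction h using TransGen.head_induction_on with
  | single h =>
    obtain ⟨s, hs, hys, rfl⟩ := h
    exact ⟨s, hs, ule_antisymm (γ_ule_of_upper (hV hs) hys hyx) hxz⟩
  | head h _ ih =>
    obtain ⟨s, hs, hys, rfl⟩ := h
    rcases ule_iff.1 (γ_ule_of_upper (hV hs) hys hyx) with h | h
    · exact ⟨s, hs, h⟩
    · exact ih h

/-- The codomains of the non-codomains below `α` are the faces between the domain and the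
codomain of `α`. -/
theorem exists_verts_γ_eq_iff {α : P.face (k + 1)} {x : P.face k} :
    (∃ s ∈ P.verts (k + 1), P.ule (k + 1) s α ∧ P.γ s = x) ↔
      P.ule k x (P.γ α) ∧ ∃ y ∈ P.δ α, P.upper k y x := by
  constructor
  · rintro ⟨s, -, hs, rfl⟩
    obtain ⟨x, hx⟩ := P.isOpetope.δ_nonempty s
    obtain ⟨y, hy, hyx⟩ := exists_δ_ule hs hx
    exact ⟨γ_ule_γ hs, y, hy, TransGen.tail' hyx ⟨s, hx, rfl⟩⟩
  · rintro ⟨hx, y, hy, hyx⟩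
    obtain ⟨s, hs, h⟩ := exists_γ_eq_of_path (fun _ h => h.1) (path_of_mem_δ α y hy) hyx hx
    exact ⟨s, hs.1, hs.2, h⟩

/-- Otherwise `s <⁻ α` as well as `s ≤⁺ α`, against disjointness, or against strictness if `s = α`.
-/
theorem γ_notMem_δ_of_ule {s α : P.face (k + 1)} (h : P.ule (k + 1) s α) : P.γ s ∉ P.δ α := by
  intro hs
  rcases ule_iff.1 h with rfl | h
  · exact P.isOpetope.strict _ _ (.single ⟨s, hs, rfl⟩)
  · exact P.isOpetope.disjoint k s α ⟨.inl (.single hs), .inl h⟩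

/-! ### The tree complex of a positive opetope -/

/-- A path of non-codomain steps from `γ(p)` to `γ(q)` is itself a `<⁻`-chain of its witnesses,
ending in `q` by uniqueness. So `≤⁻` on non-codomains is `≤⁺` pulled back along `γ`. -/
theorem dual_le_iff {p q : P.Dual (k + 1)} : p ≤ q ↔ P.ule k (P.γ p.1) (P.γ q.1) := by
  constructor
  · rintro (rfl | h)
    · exact .refl
    · exact ule_of_upper (P.upper_γ_of_lower h)
  · intro h
    rcases ule_iff.1 h with h | h
    · exact .inl (Subtype.ext (eq_of_γ_eq p.2 q.2 h))
    · have key : ∀ b, TransGen (P.stepIn (P.verts (k + 1))) (P.γ p.1) b →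
          ∃ q' ∈ P.verts (k + 1), P.γ q' = b ∧ P.lower (k + 1) p.1 q' := by
        intro b hb
        induction hb with
        | single h =>
          obtain ⟨s, hs, h, rfl⟩ := h
          exact ⟨s, hs, rfl, .single h⟩
        | tail _ h ih =>
          obtain ⟨q', -, rfl, hl⟩ := ih
          obtain ⟨s, hs, h, rfl⟩ := h
          exact ⟨s, hs, rfl, hl.tail h⟩
      obtain ⟨q', hq', h, hl⟩ := key _ (path_of_upper h)
      rw [eq_of_γ_eq hq' q.2 h] at hl
      exact .inr hl

instance : Subsingleton (P.Dual 0) where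
  allEq a b := Subtype.ext (eq_of_upperPerp a.2 b.2 (P.isOpetope.linear a.1 b.1))

theorem exists_dual_γ_eq {a b : P.face k} {α : P.face (k + 1)} (ha : P.γ α = a)
    (h : P.ule k a b) : ∃ s : P.Dual (k + 1), P.γ s.1 = b := by
  have : ∃ β, P.γ β = b := by
    rcases ule_iff.1 h with rfl | h
    · exact ⟨α, ha⟩
    · exact not_not.1 (notMem_verts_of_upper h)
  obtain ⟨β, rfl⟩ := this
  obtain ⟨s, hs, -, h⟩ := exists_verts_γ_eq β
  exact ⟨⟨s, hs⟩, h⟩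

theorem isTree_dual (P : PositiveOpetope.{u}) (k : ℕ) : IsTree (P.Dual k) := by
  have := P.isOpetope.finite k
  refine IsTree.of_common_upper_bound inferInstance ?_ ?_
  · intro a b
    cases k with
    | zero => exact ⟨a, .inl rfl, .inl (Subsingleton.elim b a)⟩
    | succ k =>
      obtain ⟨c, ha, hb⟩ := ule_common_upper_bound (P.γ a.1) (P.γ b.1)
      obtain ⟨s, rfl⟩ := exists_dual_γ_eq rfl ha
      exact ⟨s, dual_le_iff.2 ha, dual_le_iff.2 hb⟩
  · intro a b c ha hb
    cases k with
    | zero => exact .inl (.inl (Subsingleton.elim a b))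
    | succ k =>
      rw [dual_le_iff] at ha hb
      rw [dual_le_iff, dual_le_iff]
      exact ule_comparable ha hb

theorem isConvexSubtree_dual_σ (p : P.Dual (k + 1)) : IsConvexSubtree (P.dual.σ k p) := by
  cases k with
  | zero =>
    obtain ⟨v, hv, h⟩ := exists_verts_ule (P.γ p.1)
    refine ⟨⟨⟨v, hv⟩, (ule_iff_upper_of_verts hv).1 h,
      fun w _ => .inl (Subsingleton.elim (α := P.Dual 0) _ _)⟩, ⟨fun x hx y _ z _ => ?_⟩⟩
    rwa [Subsingleton.elim (α := P.Dual 0) z x]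
  | succ k =>
    -- Seen through `γ`, the set `σ(p)` consists of the faces strictly above some element of `δγ(p)`
    -- and at most `γγ(p)`; convexity is then evident.
    have mem : ∀ s : P.dual.T (k + 1), s ∈ P.dual.σ (k + 1) p ↔
        P.ule k (P.γ s.1) (P.γ (P.γ p.1)) ∧ ∃ y ∈ P.δ (P.γ p.1), P.upper k y (P.γ s.1) := by
      intro s
      rw [← exists_verts_γ_eq_iff]
      constructor
      · intro h
        exact ⟨s.1, s.2, ule_of_upper h, rfl⟩
      · rintro ⟨s', hs', h, he⟩
        rw [eq_of_γ_eq hs' s.2 he, ule_iff_upper_of_verts s.2] at h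
        exact h
    refine ⟨?_, ⟨fun x hx z hz y hy => ?_⟩⟩
    · obtain ⟨s, hs, h, he⟩ := exists_verts_γ_eq (P.γ p.1)
      refine ⟨⟨s, hs⟩, (ule_iff_upper_of_verts hs).1 h, fun w hw => ?_⟩
      exact dual_le_iff.2 (he ▸ ((mem w).1 hw).1)
    · rw [mem] at hx hz ⊢
      obtain ⟨-, w, hw, hwx⟩ := hx
      exact ⟨(dual_le_iff.1 hy.2).trans hz.1, w, hw, hwx.trans_left (dual_le_iff.1 hy.1)⟩

theorem isConstellation_dual (P : PositiveOpetope.{u}) (k : ℕ) :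
    IsConstellation (P.dual.σ k) where
  tree_left := P.isTree_dual _
  tree_right := P.isTree_dual _
  convex p := isConvexSubtree_dual_σ p
  monotone p q hpq s hs := TransGen.trans_left hs (dual_le_iff.1 hpq)
  map_top p hp := by
    refine Set.eq_univ_of_forall fun s => ?_
    obtain ⟨c, hsc, hpc⟩ := ule_common_upper_bound s.1 (P.γ p.1)
    obtain ⟨q, rfl⟩ := exists_dual_γ_eq rfl hpc
    exact (ule_iff_upper_of_verts s.2).1 (hsc.trans (dual_le_iff.1 (hp q)))
  comparable p q := by
    rintro ⟨s, hp, hq⟩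
    have := ule_comparable (ule_of_upper hp) (ule_of_upper hq)
    exact this.imp dual_le_iff.2 dual_le_iff.2

theorem isTreeComplex_dual (P : PositiveOpetope.{u}) : P.dual.IsTreeComplex where
  constellation := P.isConstellation_dual
  bottom := by
    obtain ⟨a⟩ := P.isOpetope.nonempty
    obtain ⟨v, hv, -⟩ := exists_verts_ule a
    exact Nat.card_eq_one_iff_unique.2
      ⟨inferInstanceAs (Subsingleton (P.Dual 0)), ⟨(⟨v, hv⟩ : P.Dual 0)⟩⟩
  top := by
    classical
    have hb := P.isOpetope.bounded
    have hn := Nat.find_spec hb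
    have hmin : ∀ m < Nat.find hb, _ := fun m hm => Nat.find_min hb hm
    generalize Nat.find hb = n at hn hmin
    have hne : Nonempty (P.face n) := by
      cases n with
      | zero => exact P.isOpetope.nonempty
      | succ n =>
        by_contra h
        refine hmin n n.lt_succ_self fun k hk => ?_
        rcases (Nat.succ_le_of_lt hk).eq_or_lt with rfl | hk
        exacts [not_nonempty_iff.1 h, hn k hk]
    have he := hn (n + 1) n.lt_succ_self
    -- Without faces of dimension `n + 1` the upper order is empty, so common upper bounds force
    -- equality.
    have hs : Subsingleton (P.face n) := by
      refine ⟨fun a b => ?_⟩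
      obtain ⟨c, ha, hb⟩ := ule_common_upper_bound a b
      have key : ∀ x y : P.face n, ¬ P.upper n x y := fun x y h => by
        obtain ⟨_, ⟨α, -⟩, -⟩ := TransGen.head'_iff.1 h
        exact he.false α
      rw [ule_iff] at ha hb
      simp only [key, or_false] at ha hb
      exact ha.trans hb.symm
    obtain ⟨a⟩ := hne
    refine ⟨n, Nat.card_eq_one_iff_unique.2 ⟨inferInstanceAs (Subsingleton (P.Dual n)),
      ⟨(⟨a, fun ⟨α, _⟩ => he.false α⟩ : P.Dual n)⟩⟩, fun m hm => ⟨fun x => ?_⟩⟩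
    exact (hn m hm).false x.1

end PositiveOpetope

/-! ### Faces of a positive opetope as nodes of its constellation trees -/

namespace PositiveOpetope

variable (P : PositiveOpetope.{u}) {k : ℕ}

/-- The tree complex of a positive opetope. -/
def treeComplex : TreeComplex.{u} := ⟨P.dual, P.isTreeComplex_dual⟩

/-- The face of `P` corresponding to a node of the constellation tree of its tree complex. -/
def ofNode (k : ℕ) : P.treeComplex.Star k → P.face k
  | .circle p => P.γ p.1
  | .vertex p => p.1

variable {P}

theorem ofNode_ule_iff {x y : P.treeComplex.Star k} :
    P.ule k (P.ofNode k x) (P.ofNode k y) ↔ x ≤ y := by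
  cases x with
  | circle p =>
    cases y with
    | circle q => exact dual_le_iff.symm
    | vertex q =>
      refine iff_of_false (fun h => ?_) (P.treeComplex.not_circle_le_vertex)
      rcases ule_iff.1 h with h | h
      · exact q.2 ⟨p.1, h⟩
      · exact notMem_verts_of_upper h q.2
  | vertex p =>
    cases y with
    | circle q => exact ule_iff_upper_of_verts p.2
    | vertex q =>
      rw [TreeComplex.vertex_le_vertex, ule_iff]
      refine ⟨?_, fun h => .inl (congrArg Subtype.val h)⟩
      rintro (h | h)
      · exact Subtype.ext h
      · exact (notMem_verts_of_upper h q.2).elim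

theorem ofNode_injective : Function.Injective (P.ofNode k) := fun _ _ h =>
  le_antisymm (ofNode_ule_iff.1 (h ▸ .refl)) (ofNode_ule_iff.1 (h ▸ .refl))

theorem ofNode_surjective : Function.Surjective (P.ofNode k) := by
  intro a
  by_cases h : a ∈ Set.range P.γ
  · obtain ⟨α, rfl⟩ := h
    obtain ⟨s, hs, -, h⟩ := exists_verts_γ_eq α
    exact ⟨.circle ⟨s, hs⟩, h⟩
  · exact ⟨.vertex ⟨a, h⟩, rfl⟩

theorem ofNode_upper_iff {x y : P.treeComplex.Star k} :
    P.upper k (P.ofNode k x) (P.ofNode k y) ↔ x < y := by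
  rw [lt_iff_le_not_ge, ← ofNode_ule_iff, ← ofNode_ule_iff]
  refine ⟨fun h => ⟨ule_of_upper h, not_ule_of_upper h⟩, fun h => ?_⟩
  rcases ule_iff.1 h.1 with h' | h'
  · exact (h.2 (h' ▸ .refl)).elim
  · exact h'

theorem mem_lvsCircle_iff {p : P.treeComplex.Star (k + 1)} {x : P.treeComplex.Star k} :
    x ∈ P.treeComplex.lvsCircle p ↔
      ∃ s ∈ P.verts (k + 1), P.ule (k + 1) s (P.ofNode (k + 1) p) ∧ P.γ s = P.ofNode k x := by
  constructor
  · rintro ⟨t, ht, rfl⟩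
    exact ⟨t.1, t.2, ofNode_ule_iff.2 ht.2, rfl⟩
  · rintro ⟨s, hs, h, he⟩
    cases x with
    | vertex q => exact (q.2 ⟨s, he⟩).elim
    | circle q =>
      have hq : (⟨s, hs⟩ : P.Dual (k + 1)) = q := Subtype.ext (eq_of_γ_eq hs q.2 he)
      subst hq
      exact P.treeComplex.circle_mem_lvsCircle.2 (ofNode_ule_iff.1 h)

theorem ofNode_dual_γ (p : P.treeComplex.Star (k + 1)) :
    P.ofNode k (P.treeComplex.dual.γ p) = P.γ (P.ofNode (k + 1) p) := by
  have hg := P.treeComplex.isGreatest_dual_γ p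
  apply ule_antisymm
  · obtain ⟨s, -, h, he⟩ := mem_lvsCircle_iff.1 hg.1
    exact he ▸ γ_ule_γ h
  · obtain ⟨w, hw⟩ := ofNode_surjective (P.γ (P.ofNode (k + 1) p))
    rw [← hw]
    refine ofNode_ule_iff.2 (hg.2 (mem_lvsCircle_iff.2 ?_))
    rw [hw]
    exact exists_verts_γ_eq _

theorem ofNode_mem_δ_iff {p : P.treeComplex.Star (k + 1)} {z : P.treeComplex.Star k} :
    P.ofNode k z ∈ P.δ (P.ofNode (k + 1) p) ↔ z ∈ P.treeComplex.dual.δ p := by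
  constructor
  · intro h
    -- The first step `s` of the path to the codomain is the only way out of `z`, so `γ(s)` covers
    -- `z`.
    obtain ⟨c, ⟨s, hs, hz, rfl⟩, -⟩ := TransGen.head'_iff.1 (path_of_mem_δ _ _ h)
    obtain ⟨x, hx⟩ := ofNode_surjective (P.γ s)
    refine ⟨⟨x, mem_lvsCircle_iff.2 ⟨s, hs.1, hs.2, hx.symm⟩, ?_, ?_⟩, ?_⟩
    · rw [← ofNode_upper_iff, hx]
      exact .single ⟨s, hz, rfl⟩
    · intro w hzw hwx
      rw [← ofNode_upper_iff] at hzw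
      refine hwx.not_ge ?_
      rw [← ofNode_ule_iff, hx]
      exact γ_ule_of_upper hs.1 hz hzw
    · intro h'
      obtain ⟨s', -, h₁, h₂⟩ := mem_lvsCircle_iff.1 h'
      exact γ_notMem_δ_of_ule h₁ (h₂ ▸ h)
  · rintro ⟨⟨x, hx, hzx⟩, hz⟩
    obtain ⟨s, hs, hsp, he⟩ := mem_lvsCircle_iff.1 hx
    -- The last step from `z` to `γ(s)` is witnessed by `s` itself, and covering leaves no room for
    -- other steps, so `z ∈ δ(s)`. Then `z` is in the domain of `p` or strictly above an element of
    -- it; the latter would place `z` in `lvs(p)°`.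
    obtain ⟨c, hc, s', hs', hcs, he'⟩ :=
      TransGen.tail'_iff.1 (path_of_upper (ofNode_upper_iff.2 hzx.lt))
    rw [eq_of_γ_eq hs' hs (he'.trans he.symm)] at hcs
    obtain ⟨w, rfl⟩ := ofNode_surjective c
    have hzw : z ≤ w := ofNode_ule_iff.1 (ule_of_path hc)
    have hwx : w < x := ofNode_upper_iff.1 (.single ⟨s, hcs, he⟩)
    rcases hzw.eq_or_lt with rfl | hzw
    · obtain ⟨y, hy, hyz⟩ := exists_δ_ule hsp hcs
      rcases ule_iff.1 hyz with rfl | hyz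
      · exact hy
      · refine (hz (mem_lvsCircle_iff.2 (exists_verts_γ_eq_iff.2 ⟨?_, y, hy, hyz⟩))).elim
        have : P.upperStep k (P.ofNode k z) (P.γ s) := ⟨s, hcs, rfl⟩
        exact ReflTransGen.head this (γ_ule_γ hsp)
    · exact (hzx.2 hzw hwx).elim

end PositiveOpetope

namespace PreHypergraph

/-! ### Contractions in terms of faces of a fixed dimension -/

variable {P Q : PreHypergraph.{u}} {f : P.Faces → Q.Faces} {i : ℕ}

theorem codTo_succ (α : P.face (i + 1)) : codTo i (⟨i + 1, α⟩ : P.Faces) = ⟨i, P.γ α⟩ := by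
  have : codTo i (⟨i + 1, α⟩ : P.Faces) = codTo i ⟨i, P.γ α⟩ := if_neg (by simp)
  rw [this, codTo_of_le (le_refl i)]

theorem mk_mem_dom_iff {α : P.face (i + 1)} {a : P.face i} :
    (⟨i, a⟩ : P.Faces) ∈ dom (⟨i + 1, α⟩ : P.Faces) ↔ a ∈ P.δ α := by
  constructor
  · rintro ⟨b, hb, h⟩
    cases h
    exact hb
  · exact fun h => ⟨a, h, rfl⟩

theorem exists_eq_mk {x : P.Faces} (h : x.1 = i) : ∃ a : P.face i, x = ⟨i, a⟩ := by
  obtain ⟨j, a⟩ := x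
  cases h
  exact ⟨a, rfl⟩

theorem IsContraction.map_γ (hf : IsContraction f) (α : P.face (i + 1)) :
    f ⟨i, P.γ α⟩ = codTo i (f ⟨i + 1, α⟩) := by
  rw [← hf.cod i _ rfl, codTo_succ]

theorem IsContraction.map_γ_of_eq (hf : IsContraction f) {α : P.face (i + 1)} {β : Q.face (i + 1)}
    (h : f ⟨i + 1, α⟩ = ⟨i + 1, β⟩) : f ⟨i, P.γ α⟩ = ⟨i, Q.γ β⟩ := by
  rw [hf.map_γ, h, codTo_succ]

theorem IsContraction.map_γ_of_le (hf : IsContraction f) {α : P.face (i + 1)}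
    (h : (f ⟨i + 1, α⟩).1 ≤ i) : f ⟨i, P.γ α⟩ = f ⟨i + 1, α⟩ := by
  rw [hf.map_γ, codTo_of_le h]

theorem notMem_ker_mk {a : P.face i} {x : Q.face i} (h : f ⟨i, a⟩ = ⟨i, x⟩) :
    (⟨i, a⟩ : P.Faces) ∉ ker f := by
  simp [ker, h]

theorem IsContraction.mem_δ (hf : IsContraction f) {α : P.face (i + 1)} {β : Q.face (i + 1)}
    (h : f ⟨i + 1, α⟩ = ⟨i + 1, β⟩) {a : P.face i} (ha : a ∈ P.δ α) {x : Q.face i}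
    (hx : f ⟨i, a⟩ = ⟨i, x⟩) : x ∈ Q.δ β := by
  have := (hf.dom_zero ⟨i + 1, α⟩ (by simp) (by rw [h])).mapsTo
    ⟨mk_mem_dom_iff.2 ha, notMem_ker_mk hx⟩
  rwa [hx, h, mk_mem_dom_iff] at this

theorem IsContraction.exists_δ_of_eq (hf : IsContraction f) {α : P.face (i + 1)} {y : Q.face i}
    (h : f ⟨i + 1, α⟩ = ⟨i, y⟩) : ∃ a ∈ P.δ α, f ⟨i, a⟩ = ⟨i, y⟩ := by
  obtain ⟨a, ⟨⟨b, hb, rfl⟩, -⟩, ha'⟩ := (hf.dom_one ⟨i + 1, α⟩ (by rw [h])).surjOn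
    (Set.mem_singleton _)
  exact ⟨b, hb, ha'.trans h⟩

theorem IsContraction.eq_of_δ_of_eq (hf : IsContraction f) {α : P.face (i + 1)} {y : Q.face i}
    (h : f ⟨i + 1, α⟩ = ⟨i, y⟩) {a : P.face i} (ha : a ∈ P.δ α) {x : Q.face i}
    (hx : f ⟨i, a⟩ = ⟨i, x⟩) : x = y := by
  have : f ⟨i, a⟩ = f ⟨i + 1, α⟩ := (hf.dom_one ⟨i + 1, α⟩ (by rw [h])).mapsTo
    ⟨mk_mem_dom_iff.2 ha, notMem_ker_mk hx⟩
  rw [hx, h] at this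
  cases this
  rfl

theorem IsContraction.le_dim (hf : IsContraction f) {α : P.face (i + 1)} {a : P.face i}
    (ha : a ∈ P.δ α) {x : Q.face i} (hx : f ⟨i, a⟩ = ⟨i, x⟩) : i ≤ (f ⟨i + 1, α⟩).1 := by
  by_contra h
  exact notMem_ker_mk hx (hf.dom_many ⟨i + 1, α⟩ (by simp only; omega) (mk_mem_dom_iff.2 ha))

/-- The two cases for the value of a contraction at a face with a domain face not in the kernel. -/
theorem IsContraction.cases_of_δ (hf : IsContraction f) {α : P.face (i + 1)} {a : P.face i}
    (ha : a ∈ P.δ α) {x : Q.face i} (hx : f ⟨i, a⟩ = ⟨i, x⟩) :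
    (∃ β, f ⟨i + 1, α⟩ = ⟨i + 1, β⟩) ∨ f ⟨i + 1, α⟩ = ⟨i, x⟩ := by
  have h₁ := hf.le_dim ha hx
  have h₂ : (f ⟨i + 1, α⟩).1 ≤ i + 1 := hf.dim_le _
  rcases h₂.eq_or_lt with h | h
  · exact .inl (exists_eq_mk h)
  · obtain ⟨y, hy⟩ := exists_eq_mk (show (f ⟨i + 1, α⟩).1 = i by omega)
    rw [hf.eq_of_δ_of_eq hy ha hx]
    exact .inr hy

theorem IsContraction.injOn_δ (hf : IsContraction f) {α : P.face (i + 1)}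
    {a b : P.face i} (ha : a ∈ P.δ α) (hb : b ∈ P.δ α) {x : Q.face i} (hx : f ⟨i, a⟩ = ⟨i, x⟩)
    (hy : f ⟨i, b⟩ = ⟨i, x⟩) : a = b := by
  have ha' := And.intro (mk_mem_dom_iff.2 ha) (notMem_ker_mk hx)
  have hb' := And.intro (mk_mem_dom_iff.2 hb) (notMem_ker_mk hy)
  have : (⟨i, a⟩ : P.Faces) = ⟨i, b⟩ := by
    rcases hf.cases_of_δ ha hx with ⟨β, h⟩ | h
    · exact (hf.dom_zero ⟨i + 1, α⟩ (by simp) (by rw [h])).injOn ha' hb' (hx.trans hy.symm)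
    · exact (hf.dom_one ⟨i + 1, α⟩ (by rw [h])).injOn ha' hb' (hx.trans hy.symm)
  cases this
  rfl

/-- A criterion for contractions. -/
theorem IsContraction.of_faces (hdim : ∀ (i : ℕ) (a : P.face i), (f ⟨i, a⟩).1 ≤ i)
    (hγ : ∀ (i : ℕ) (α : P.face (i + 1)) (β : Q.face (i + 1)),
      f ⟨i + 1, α⟩ = ⟨i + 1, β⟩ → f ⟨i, P.γ α⟩ = ⟨i, Q.γ β⟩)
    (hγ' : ∀ (i : ℕ) (α : P.face (i + 1)), (f ⟨i + 1, α⟩).1 ≤ i → f ⟨i, P.γ α⟩ = f ⟨i + 1, α⟩)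
    (hmem : ∀ (i : ℕ) (α : P.face (i + 1)) (β : Q.face (i + 1)), f ⟨i + 1, α⟩ = ⟨i + 1, β⟩ →
      ∀ a ∈ P.δ α, ∀ x : Q.face i, f ⟨i, a⟩ = ⟨i, x⟩ → x ∈ Q.δ β)
    (hex : ∀ (i : ℕ) (α : P.face (i + 1)) (β : Q.face (i + 1)), f ⟨i + 1, α⟩ = ⟨i + 1, β⟩ →
      ∀ x ∈ Q.δ β, ∃ a ∈ P.δ α, f ⟨i, a⟩ = ⟨i, x⟩)
    (hinj : ∀ (i : ℕ) (α : P.face (i + 1)), ∀ a ∈ P.δ α, ∀ b ∈ P.δ α, ∀ x : Q.face i,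
      f ⟨i, a⟩ = ⟨i, x⟩ → f ⟨i, b⟩ = ⟨i, x⟩ → a = b)
    (hone : ∀ (i : ℕ) (α : P.face (i + 1)) (y : Q.face i), f ⟨i + 1, α⟩ = ⟨i, y⟩ →
      (∃ a ∈ P.δ α, f ⟨i, a⟩ = ⟨i, y⟩) ∧
        ∀ a ∈ P.δ α, ∀ x : Q.face i, f ⟨i, a⟩ = ⟨i, x⟩ → x = y)
    (hmany : ∀ (i : ℕ) (α : P.face (i + 1)), ∀ a ∈ P.δ α, ∀ x : Q.face i,
      f ⟨i, a⟩ = ⟨i, x⟩ → i ≤ (f ⟨i + 1, α⟩).1) : IsContraction f := by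
  have hk : ∀ (i : ℕ) (a : P.face i), (⟨i, a⟩ : P.Faces) ∉ ker f →
      ∃ x : Q.face i, f ⟨i, a⟩ = ⟨i, x⟩ :=
    fun i a h => exists_eq_mk (le_antisymm (hdim i a) (not_lt.1 h))
  have hi : ∀ (i : ℕ) (α : P.face (i + 1)),
      Set.InjOn f (dom (⟨i + 1, α⟩ : P.Faces) \ ker f) := by
    rintro i α _ ⟨⟨a, ha, rfl⟩, hka⟩ _ ⟨⟨b, hb, rfl⟩, -⟩ h
    obtain ⟨x, hx⟩ := hk i a hka
    rw [hinj i α a ha b hb x hx (h ▸ hx)]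
  refine ⟨fun q => hdim _ _, ?_, ?_, ?_, ?_⟩
  · rintro k ⟨_, α⟩ rfl
    rw [codTo_succ]
    rcases (hdim _ α).eq_or_lt with h | h
    · obtain ⟨β, hβ⟩ := exists_eq_mk h
      rw [hγ k α β hβ, hβ, codTo_succ]
    · rw [hγ' k α (Nat.le_of_lt_succ h), codTo_of_le (Nat.le_of_lt_succ h)]
  · rintro ⟨_ | i, α⟩ hpos h
    · exact (lt_irrefl _ hpos).elim
    · obtain ⟨β, hβ⟩ := exists_eq_mk h
      refine ⟨?_, hi i α, ?_⟩
      · rintro _ ⟨⟨a, ha, rfl⟩, hka⟩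
        obtain ⟨x, hx⟩ := hk i a hka
        rw [hβ, hx, mk_mem_dom_iff]
        exact hmem i α β hβ a ha x hx
      · rw [hβ]
        rintro _ ⟨x, hx, rfl⟩
        obtain ⟨a, ha, h⟩ := hex i α β hβ x hx
        exact ⟨_, ⟨mk_mem_dom_iff.2 ha, notMem_ker_mk h⟩, h⟩
  · rintro ⟨_ | i, α⟩ h
    · simp at h
    · obtain ⟨y, hy⟩ := exists_eq_mk (Nat.succ_injective h : (f ⟨i + 1, α⟩).1 = i)
      obtain ⟨⟨b, hb, hby⟩, h₂⟩ := hone i α y hy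
      refine ⟨?_, hi i α, ?_⟩
      · rintro _ ⟨⟨a, ha, rfl⟩, hka⟩
        obtain ⟨x, hx⟩ := hk i a hka
        rw [Set.mem_singleton_iff, hx, hy, h₂ a ha x hx]
      · rintro _ rfl
        exact ⟨_, ⟨mk_mem_dom_iff.2 hb, notMem_ker_mk hby⟩, hby.trans hy.symm⟩
  · rintro ⟨_ | i, α⟩ h _ hx
    · exact hx.elim
    · obtain ⟨a, ha, rfl⟩ := hx
      by_contra hka
      obtain ⟨x, hx⟩ := hk i a hka
      have := hmany i α a ha x hx
      simp only at h
      omega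

/-- Dimensionwise bijections which commute with `γ` and `δ` are contractions. -/
theorem IsContraction.of_bijective (e : ∀ i, P.face i → Q.face i)
    (hb : ∀ i, Function.Bijective (e i))
    (hγ : ∀ (i : ℕ) (α : P.face (i + 1)), e i (P.γ α) = Q.γ (e (i + 1) α))
    (hδ : ∀ (i : ℕ) (α : P.face (i + 1)) (a : P.face i), e i a ∈ Q.δ (e (i + 1) α) ↔ a ∈ P.δ α) :
    IsContraction (fun x : P.Faces => (⟨x.1, e x.1 x.2⟩ : Q.Faces)) := by
  refine IsContraction.of_faces (fun _ _ => le_rfl) ?_ ?_ ?_ ?_ ?_ ?_ ?_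
  · rintro i α _ ⟨⟩
    rw [hγ]
  · intro i α h
    simp at h
  · rintro i α _ ⟨⟩ a ha _ ⟨⟩
    exact (hδ i α a).2 ha
  · rintro i α _ ⟨⟩ x hx
    obtain ⟨a, rfl⟩ := (hb i).2 x
    exact ⟨a, (hδ i α a).1 hx, rfl⟩
  · rintro i α a ha b hb' _ ⟨⟩ h
    simp only [Sigma.mk.injEq, heq_eq_eq, true_and] at h
    exact ((hb i).1 h).symm
  · intro i α y h
    have := congrArg Sigma.fst h
    simp at this
  · intro i α a ha x h
    simp

end PreHypergraph

open PreHypergraph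

/-! ### Contractions and iterated codomains -/

namespace PreHypergraph

variable {P Q : PreHypergraph.{u}} {f : P.Faces → Q.Faces}

theorem codTo_mk_succ {m l : ℕ} (h : m ≤ l) (a : P.face (l + 1)) :
    codTo m (⟨l + 1, a⟩ : P.Faces) = codTo m ⟨l, P.γ a⟩ := if_neg (by omega)

theorem exists_codTo_eq {m l : ℕ} (h : m ≤ l) (a : P.face l) :
    ∃ α : P.face m, codTo m (⟨l, a⟩ : P.Faces) = ⟨m, α⟩ := by
  induction l, h using Nat.le_induction with
  | base => exact ⟨a, codTo_of_le (le_refl m)⟩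
  | succ l h ih =>
    rw [codTo_mk_succ h]
    exact ih _

theorem IsContraction.map_codTo (hf : IsContraction f) {m l : ℕ} (h : m ≤ l) (a : P.face l) :
    f (codTo m ⟨l, a⟩) = codTo m (f ⟨l, a⟩) := by
  induction l, h using Nat.le_induction with
  | base => rw [codTo_of_le (le_refl m), codTo_of_le (hf.dim_le ⟨m, a⟩)]
  | succ l h ih =>
    rw [codTo_mk_succ h, ih]
    have hd : (f ⟨l + 1, a⟩).1 ≤ l + 1 := hf.dim_le _
    rcases hd.eq_or_lt with hd | hd
    · obtain ⟨β, hβ⟩ := exists_eq_mk hd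
      rw [hf.map_γ_of_eq hβ, hβ, codTo_mk_succ h]
    · rw [hf.map_γ_of_le (Nat.le_of_lt_succ hd)]

end PreHypergraph

/-! ### Lower adjoints of contractions -/

namespace TreeComplex

variable {S T : TreeComplex.{u}} {i : ℕ}

/-- `G` assigns to each node `x` the least node of its dimension whose image under `f` is
at least `x`; this image is `x`. -/
structure IsLowerAdjoint (f : T.dual.Faces → S.dual.Faces) (G : ∀ i, S.Star i → T.Star i) :
    Prop where
  le_iff : ∀ {i : ℕ} {x : S.Star i} {t : T.Star i},
    G i x ≤ t ↔ ∃ y : S.Star i, f ⟨i, t⟩ = ⟨i, y⟩ ∧ x ≤ y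
  map_eq : ∀ {i : ℕ} (x : S.Star i), f ⟨i, G i x⟩ = ⟨i, x⟩

theorem mk_eq_mk_iff {x y : S.Star i} :
    ((⟨i, x⟩ : S.dual.Faces) = ⟨i, y⟩) ↔ x = y := by
  constructor
  · intro h
    cases h
    rfl
  · rintro rfl
    rfl

namespace IsLowerAdjoint

variable {f : T.dual.Faces → S.dual.Faces} {G : ∀ i, S.Star i → T.Star i}

theorem le_of_map_eq (hG : IsLowerAdjoint f G) {x y : S.Star i} {t : T.Star i} (h : G i x ≤ t)
    (ht : f ⟨i, t⟩ = ⟨i, y⟩) : x ≤ y := by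
  obtain ⟨z, hz, hxz⟩ := hG.le_iff.1 h
  rwa [← mk_eq_mk_iff.1 (hz.symm.trans ht)]

theorem le_iff_le (hG : IsLowerAdjoint f G) {x y : S.Star i} : G i x ≤ G i y ↔ x ≤ y :=
  ⟨fun h => hG.le_of_map_eq h (hG.map_eq y), fun h => hG.le_iff.2 ⟨y, hG.map_eq y, h⟩⟩

theorem map_sup (hG : IsLowerAdjoint f G) {x y z : S.Star i} (h : IsLUB {x, y} z) :
    IsLUB {G i x, G i y} (G i z) := by
  constructor
  · rintro w (rfl | rfl)
    · exact hG.le_iff_le.2 (h.1 (by simp))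
    · exact hG.le_iff_le.2 (h.1 (by simp))
  · intro t ht
    have hx : G i x ≤ t := ht (by simp)
    have hy : G i y ≤ t := ht (by simp)
    obtain ⟨w, hw, hxw⟩ := hG.le_iff.1 hx
    refine hG.le_iff.2 ⟨w, hw, h.2 ?_⟩
    rintro v (rfl | rfl)
    exacts [hxw, hG.le_of_map_eq hy hw]

/-- A contraction is determined by its lower adjoint. -/
theorem contraction_ext {f' : T.dual.Faces → S.dual.Faces} (hf : IsContraction f)
    (hf' : IsContraction f') (hG : IsLowerAdjoint f G) (hG' : IsLowerAdjoint f' G) : f = f' := by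
  -- A value of dimension `i` at `t` is the greatest `y` with `G i y ≤ t`, which depends on `G`
  -- only.
  have key : ∀ {g g' : T.dual.Faces → S.dual.Faces} (_ : IsLowerAdjoint g G)
      (_ : IsLowerAdjoint g' G) (i : ℕ) (t : T.Star i) (y : S.Star i), g ⟨i, t⟩ = ⟨i, y⟩ →
      g' ⟨i, t⟩ = ⟨i, y⟩ := by
    intro g g' hg hg' i t y h
    obtain ⟨y', h', hy⟩ := hg'.le_iff.1 (hg.le_iff.2 ⟨y, h, le_rfl⟩)
    rw [h', mk_eq_mk_iff]
    exact le_antisymm (hg.le_of_map_eq (hg'.le_iff.2 ⟨y', h', le_rfl⟩) h) hy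
  funext ⟨i, t⟩
  induction i with
  | zero =>
    obtain ⟨y, hy⟩ := exists_eq_mk (Nat.le_zero.1 (hf.dim_le ⟨0, t⟩))
    rw [hy, key hG hG' 0 t y hy]
  | succ i ih =>
    by_cases h : (f ⟨i + 1, t⟩).1 = i + 1
    · obtain ⟨y, hy⟩ := exists_eq_mk h
      rw [hy, key hG hG' _ t y hy]
    · by_cases h' : (f' ⟨i + 1, t⟩).1 = i + 1
      · obtain ⟨y, hy⟩ := exists_eq_mk h'
        rw [hy, key hG' hG _ t y hy]
      · have h₁ : (f ⟨i + 1, t⟩).1 ≤ i + 1 := hf.dim_le _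
        have h₂ : (f' ⟨i + 1, t⟩).1 ≤ i + 1 := hf'.dim_le _
        -- When both maps lower the dimension, their values at `t` are their values at `γ(t)`.
        rw [← hf.map_γ_of_le (by omega), ← hf'.map_γ_of_le (by omega)]
        exact ih _

/-- The description of a contraction with lower adjoint induced by a tree complex embedding. -/
theorem map_eq_iff_isDualImage {φ : S ⟶ T} (hf : IsContraction f)
    (hφ : IsLowerAdjoint f (nodeMap φ.app)) (t : T.dual.Faces) (s : S.dual.Faces) :
    f t = s ↔ IsDualImage φ t s := by
  obtain ⟨i, t⟩ := t
  rcases hy : f ⟨i, t⟩ with ⟨j, y⟩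
  have hji : j ≤ i := by
    have := hf.dim_le ⟨i, t⟩
    rwa [hy] at this
  -- In dimension `m < i` the domain of `t` is `δ(α)` with `α = γ⁽ᵐ⁺¹⁾(t)`, and `f` commutes with
  -- iterated codomains.
  have hcod : ∀ m, m < i → ∃ α : T.dual.face (m + 1),
      domTo m (⟨i, t⟩ : T.dual.Faces) = dom (⟨m + 1, α⟩ : T.dual.Faces) ∧
        f ⟨m + 1, α⟩ = codTo (m + 1) ⟨j, y⟩ := by
    intro m hm
    obtain ⟨α, hα⟩ := exists_codTo_eq (Nat.succ_le_of_lt hm) (P := T.dual) t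
    refine ⟨α, ?_, ?_⟩
    · rw [domTo, if_neg hm.ne', if_pos hm, hα]
    · rw [← hα, hf.map_codTo (Nat.succ_le_of_lt hm), hy]
  have hself : domTo i (⟨i, t⟩ : T.dual.Faces) = {⟨i, t⟩} := if_pos rfl
  have hgreatest : IsGreatest (below φ ⟨i, t⟩ j) y := by
    rcases hji.eq_or_lt with rfl | hji
    · refine ⟨⟨t, by rw [hself]; rfl, hφ.le_iff.2 ⟨y, hy, le_rfl⟩⟩, ?_⟩
      rintro x ⟨t', ht', hx⟩
      rw [hself] at ht'
      rw [mk_eq_mk_iff.1 (Set.mem_singleton_iff.1 ht')] at hx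
      exact hφ.le_of_map_eq hx hy
    · obtain ⟨α, hdom, hα⟩ := hcod j hji
      rw [codTo_of_le (Nat.le_succ j)] at hα
      constructor
      · obtain ⟨a, ha, hay⟩ := hf.exists_δ_of_eq hα
        exact ⟨a, hdom ▸ mk_mem_dom_iff.2 ha, hφ.le_iff.2 ⟨y, hay, le_rfl⟩⟩
      · rintro x ⟨t', ht', hx⟩
        rw [hdom] at ht'
        replace ht' := mk_mem_dom_iff.1 ht'
        obtain ⟨y', hy', hxy⟩ := hφ.le_iff.1 hx
        rwa [hf.eq_of_δ_of_eq hα ht' hy'] at hxy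
  -- For `j < m < i` the value at `α` has dimension `j < m`, so all of `δ(α)` lies in the kernel.
  have hmax : ∀ m, (below φ ⟨i, t⟩ m).Nonempty → m ≤ j := by
    rintro m ⟨x, t', ht', hx⟩
    obtain ⟨y', hy', -⟩ := hφ.le_iff.1 hx
    rcases lt_trichotomy m i with hm | rfl | hm
    · obtain ⟨α, hdom, hα⟩ := hcod m hm
      rw [hdom] at ht'
      replace ht' := mk_mem_dom_iff.1 ht'
      have := hf.le_dim ht' hy'
      rw [hα] at this
      by_contra! hlt
      rw [codTo_of_le (show (⟨j, y⟩ : S.dual.Faces).1 ≤ m + 1 by simp only; omega)] at this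
      simp only at this
      omega
    · rw [hself] at ht'
      rw [Set.mem_singleton_iff.1 ht', hy] at hy'
      exact (congrArg Sigma.fst hy').ge
    · rw [domTo, if_neg hm.ne, if_neg hm.not_gt] at ht'
      exact ht'.elim
  have hmax' : Maximal (fun m => (below φ ⟨i, t⟩ m).Nonempty) j :=
    ⟨⟨y, hgreatest.1⟩, fun m hm _ => hmax m hm⟩
  constructor
  · rintro rfl
    exact ⟨hmax', hgreatest.1, fun x hx _ => hgreatest.2 hx⟩
  · obtain ⟨m, x⟩ := s
    rintro ⟨h₁, h₂⟩
    obtain rfl : j = m := le_antisymm (h₁.2 hmax'.1 (hmax m h₁.1)) (hmax m h₁.1)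
    refine mk_eq_mk_iff.2 ?_
    exact le_antisymm (h₂.2 hgreatest.1 (hgreatest.2 h₂.1)) (hgreatest.2 h₂.1)

end IsLowerAdjoint

/-! ### The lower adjoint of a contraction epimorphism -/

section Contraction

variable {f : T.dual.Faces → S.dual.Faces}

/-- Along a step witnessed by `α`, either `α` keeps its dimension and the values form a step, or `α`
collapses and the value is unchanged. -/
theorem exists_map_of_le (hf : IsContraction f) {a b : T.Star i} {x : S.Star i} (hab : a ≤ b)
    (hx : f ⟨i, a⟩ = ⟨i, x⟩) : ∃ y : S.Star i, f ⟨i, b⟩ = ⟨i, y⟩ ∧ x ≤ y := by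
  rcases hab.eq_or_lt with rfl | hab'
  · exact ⟨x, hx, le_rfl⟩
  have step : ∀ {a b : T.Star i} {x : S.Star i}, T.dual.upperStep i a b → f ⟨i, a⟩ = ⟨i, x⟩ →
      ∃ y : S.Star i, f ⟨i, b⟩ = ⟨i, y⟩ ∧ x ≤ y := by
    rintro a _ x ⟨α, ha, rfl⟩ hx
    rcases hf.cases_of_δ ha hx with ⟨β, h⟩ | h
    · exact ⟨S.dual.γ β, hf.map_γ_of_eq h, (S.lt_γ_of_mem_dual_δ (hf.mem_δ h ha hx)).le⟩
    · refine ⟨x, (hf.map_γ_of_le ?_).trans h, le_rfl⟩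
      rw [h]
  have hup := T.dual_upper_iff.2 hab'
  clear hab hab'
  induction hup with
  | single h => exact step h hx
  | tail _ h ih =>
    obtain ⟨y, hy, hxy⟩ := ih
    obtain ⟨z, hz, hyz⟩ := step h hy
    exact ⟨z, hz, hxy.trans hyz⟩

/-- Incomparable `a`, `b` lie below distinct sons of their supremum `t°`, that is, distinct elements
of `δ(t•)`. Their values have the common lower bound `x`, so they coincide, either in an antichain
`δ(β)` or as the single value of a collapsed face; this contradicts injectivity on `δ(t•)`. -/
theorem comparable_of_map_le (hf : IsContraction f) {a b : T.Star i} {x y : S.Star i}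
    (ha : f ⟨i, a⟩ = ⟨i, x⟩) (hb : f ⟨i, b⟩ = ⟨i, y⟩) (hxy : x ≤ y) : a ≤ b ∨ b ≤ a := by
  by_contra! hn
  have hT := T.isTree_star i
  obtain ⟨m, hm⟩ := hT.exists_sup a b
  have ham : a ≤ m := hm.1 (by simp)
  have hbm : b ≤ m := hm.1 (by simp)
  have ham' : a < m := lt_of_le_of_ne ham (by rintro rfl; exact hn.2 hbm)
  have hbm' : b < m := lt_of_le_of_ne hbm (by rintro rfl; exact hn.1 ham)
  obtain ⟨t, rfl⟩ := T.exists_circle_of_lt ham'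
  obtain ⟨c, hac, hc⟩ := hT.exists_le_covBy ham'
  obtain ⟨d, hbd, hd⟩ := hT.exists_le_covBy hbm'
  have hne : c ≠ d := by
    rintro rfl
    refine hc.lt.not_ge (hm.2 ?_)
    rintro z (rfl | rfl)
    exacts [hac, hbd]
  have hc' := T.mem_dual_δ_vertex.2 hc
  have hd' := T.mem_dual_δ_vertex.2 hd
  obtain ⟨z, hz, hxz⟩ := exists_map_of_le hf hac ha
  obtain ⟨w, hw, hyw⟩ := exists_map_of_le hf hbd hb
  have hzw : z = w := by
    rcases hf.cases_of_δ hc' hz with ⟨β, h⟩ | h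
    · exact S.eq_of_mem_dual_δ (hf.mem_δ h hc' hz) (hf.mem_δ h hd' hw) hxz (hxy.trans hyw)
    · exact (hf.eq_of_δ_of_eq h hd' hw).symm
  subst hzw
  exact hne (hf.injOn_δ hc' hd' hz hw)

theorem exists_map_eq (hf : IsContraction f) (hs : Function.Surjective f) (x : S.Star i) :
    ∃ a : T.Star i, f ⟨i, a⟩ = ⟨i, x⟩ := by
  obtain ⟨⟨l, t⟩, ht⟩ := hs ⟨i, x⟩
  have hil : i ≤ l := by
    have := hf.dim_le ⟨l, t⟩
    rwa [ht] at this
  obtain ⟨α, hα⟩ := exists_codTo_eq (P := T.dual) hil t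
  refine ⟨α, ?_⟩
  have := hf.map_codTo hil t
  rwa [hα, ht, codTo_of_le (le_refl i)] at this

/-- By comparability a minimal element of the fibre over `x` is least among all `t` with value at
least `x`. -/
theorem exists_isLowerAdjoint (hf : IsContraction f) (hs : Function.Surjective f) :
    ∃ G : ∀ i, S.Star i → T.Star i, IsLowerAdjoint f G := by
  have key : ∀ (i : ℕ) (x : S.Star i), ∃ a : T.Star i, f ⟨i, a⟩ = ⟨i, x⟩ ∧
      ∀ (t : T.Star i) (y : S.Star i), f ⟨i, t⟩ = ⟨i, y⟩ → x ≤ y → a ≤ t := by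
    intro i x
    have := (T.isTree_star i).finite
    obtain ⟨a, ha, hmin⟩ := (Set.toFinite {a : T.Star i | f ⟨i, a⟩ = ⟨i, x⟩}).exists_minimal
      (exists_map_eq hf hs x)
    refine ⟨a, ha, fun t y ht hxy => ?_⟩
    rcases comparable_of_map_le hf ha ht hxy with h | h
    · exact h
    · obtain ⟨z, hz, hyz⟩ := exists_map_of_le hf h ht
      have hzx : z = x := mk_eq_mk_iff.1 (hz.symm.trans ha)
      have hyx : y = x := le_antisymm (hyz.trans hzx.le) hxy
      exact hmin (show f ⟨i, t⟩ = ⟨i, x⟩ by rw [ht, hyx]) h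
  choose G hG hG' using key
  refine ⟨G, ⟨fun {i x t} => ⟨fun h => exists_map_of_le hf h (hG i x), ?_⟩, fun {i} x => hG i x⟩⟩
  rintro ⟨y, hy, hxy⟩
  exact hG' i x t y hy hxy

variable {G : ∀ i, S.Star i → T.Star i}

theorem IsLowerAdjoint.exists_vertex (hf : IsContraction f) (hG : IsLowerAdjoint f G)
    (s : S.T i) : ∃ t : T.T i, G i (Node.vertex s) = Node.vertex t := by
  cases h : G i (Node.vertex s) with
  | vertex t => exact ⟨t, rfl⟩
  | circle t =>
    exfalso
    have hs := hG.map_eq (Node.vertex s : S.Star i)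
    -- If `t•` kept its dimension, the value at `t°` would be a codomain, hence a circle. So `t•`
    -- collapses to the vertex of `s`, and some element of `δ(t•)` has the same value, against
    -- minimality.
    have key : ∃ a : T.Star i, a < Node.circle t ∧ f ⟨i, a⟩ = ⟨i, (Node.vertex s : S.Star i)⟩ := by
      have hd : (f ⟨i + 1, (Node.vertex t : T.Star (i + 1))⟩).1 ≤ i + 1 := hf.dim_le _
      rcases hd.eq_or_lt with hd | hd
      · obtain ⟨β, hβ⟩ := exists_eq_mk hd
        have := hf.map_γ_of_eq hβ
        rw [T.dual_γ_vertex, ← h, hs] at this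
        obtain ⟨r, -, hr⟩ := (S.isGreatest_dual_γ β).1
        cases (mk_eq_mk_iff.1 this).trans hr
      · have := hf.map_γ_of_le (Nat.le_of_lt_succ hd)
        rw [T.dual_γ_vertex, ← h, hs] at this
        obtain ⟨a, ha, ha'⟩ := hf.exists_δ_of_eq this.symm
        exact ⟨a, (T.mem_dual_δ_vertex.1 ha).lt, ha'⟩
    obtain ⟨a, ha, hfa⟩ := key
    rw [← h] at ha
    exact ha.not_ge (hG.le_iff.2 ⟨_, hfa, le_rfl⟩)

theorem IsLowerAdjoint.map_circle (hf : IsContraction f) (hG : IsLowerAdjoint f G)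
    {s : S.T (i + 1)} {t : T.T (i + 1)} (h : G (i + 1) (Node.vertex s) = Node.vertex t) :
    G i (Node.circle s) = Node.circle t := by
  have hst : f ⟨i + 1, (Node.vertex t : T.Star (i + 1))⟩ =
      ⟨i + 1, (Node.vertex s : S.Star (i + 1))⟩ := h ▸ hG.map_eq _
  have hγ := hf.map_γ_of_eq hst
  rw [T.dual_γ_vertex, S.dual_γ_vertex] at hγ
  have hle : G i (Node.circle s) ≤ Node.circle t := hG.le_iff.2 ⟨_, hγ, le_rfl⟩
  by_contra hne
  -- A son of `t°` is in `δ(t•)`, so its value, if of dimension `i`, is a son of `s°` and cannot be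
  -- above `s°`.
  obtain ⟨a, hsa, ha⟩ := (T.isTree_star i).exists_le_covBy (lt_of_le_of_ne hle hne)
  obtain ⟨y, hy, hsy⟩ := hG.le_iff.1 hsa
  have := hf.mem_δ hst (T.mem_dual_δ_vertex.2 ha) hy
  exact (S.mem_dual_δ_vertex.1 this).lt.not_ge hsy

/-- The tree complex embedding induced by a contraction epimorphism. -/
theorem exists_hom_isLowerAdjoint (hf : IsContraction f) (hs : Function.Surjective f) :
    ∃ φ : S ⟶ T, IsLowerAdjoint f (nodeMap φ.app) := by
  obtain ⟨G, hG⟩ := exists_isLowerAdjoint hf hs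
  choose app happ using fun (i : ℕ) (s : S.T i) => hG.exists_vertex hf s
  have hmap : G = nodeMap app := by
    funext i x
    cases x with
    | vertex s => exact happ i s
    | circle s => exact hG.map_circle hf (happ (i + 1) s)
  rw [hmap] at hG
  refine ⟨⟨app, fun i a b => ?_, fun i x y => hG.le_iff_le, fun i x y z h => hG.map_sup h⟩, hG⟩
  -- The order of `S.T i` is that of the circles one dimension below; dimension zero is a singleton.
  cases i with
  | zero =>
    have := (Nat.card_eq_one_iff_unique.1 S.isTreeComplex.bottom).1
    rw [Subsingleton.elim a b]
    exact iff_of_true le_rfl le_rfl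
  | succ i => exact hG.le_iff_le (i := i) (x := .circle a) (y := .circle b)

theorem IsLowerAdjoint.app_eq_iff {φ : S ⟶ T} (hφ : IsLowerAdjoint f (nodeMap φ.app)) {s : S.T i}
    {t : T.T i} : φ.app i s = t ↔
      f ⟨i, (Node.vertex t : T.Star i)⟩ = ⟨i, (Node.vertex s : S.Star i)⟩ := by
  constructor
  · rintro rfl
    exact hφ.map_eq (Node.vertex s : S.Star i)
  · intro h
    have hle : nodeMap φ.app i (Node.vertex s) ≤ (Node.vertex t : T.Star i) :=
      hφ.le_iff.2 ⟨_, h, le_rfl⟩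
    exact T.vertex_le_vertex.1 hle

end Contraction

end TreeComplex

namespace TreeComplex

/-! ### The contraction induced by a tree complex embedding -/

section DualMap

variable {S T : TreeComplex.{u}} {i : ℕ} (φ : S ⟶ T)

/-- Preservation of suprema makes this finite nonempty set closed under binary suprema. -/
theorem exists_isGreatest {t : T.Star i} {x : S.Star i} (h : nodeMap φ.app i x ≤ t) :
    ∃ y, IsGreatest {y : S.Star i | nodeMap φ.app i y ≤ t} y := by
  have hS := S.isTree_star i
  have := hS.finite
  obtain ⟨m, hm, hmax⟩ := (Set.toFinite {y : S.Star i | nodeMap φ.app i y ≤ t}).exists_maximal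
    ⟨x, h⟩
  refine ⟨m, hm, fun y hy => ?_⟩
  obtain ⟨z, hz⟩ := hS.exists_sup m y
  refine (hz.1 (by simp)).trans (hmax ?_ (hz.1 (by simp)))
  refine (φ.map_sup i m y z hz).2 ?_
  rintro w (rfl | rfl)
  exacts [hm, hy]

theorem exists_isGreatest_zero (t : T.Star 0) :
    ∃ y, IsGreatest {y : S.Star 0 | nodeMap φ.app 0 y ≤ t} y := by
  obtain ⟨v, hv⟩ := T.exists_vertex_le t
  obtain ⟨-, ⟨s⟩⟩ := Nat.card_eq_one_iff_unique.1 S.isTreeComplex.bottom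
  have := (Nat.card_eq_one_iff_unique.1 T.isTreeComplex.bottom).1
  rw [Subsingleton.elim v (φ.app 0 s)] at hv
  exact exists_isGreatest φ (x := .vertex s) hv

open Classical in
/-- The contraction induced by a tree complex embedding, on nodes of dimension `i`: the greatest
node of dimension `i` whose image is below `t`, if any, and the value at `γ(t)` otherwise. -/
noncomputable def dualMapAux : ∀ i : ℕ, T.Star i → S.dual.Faces
  | 0, t => ⟨0, (exists_isGreatest_zero φ t).choose⟩
  | i + 1, t =>
    if h : ∃ y, IsGreatest {y : S.Star (i + 1) | nodeMap φ.app (i + 1) y ≤ t} y then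
      ⟨i + 1, h.choose⟩ else dualMapAux i (T.dual.γ t)

/-- The contraction induced by a tree complex embedding. -/
noncomputable def dualMap (t : T.dual.Faces) : S.dual.Faces := dualMapAux φ t.1 t.2

variable {φ}

theorem dualMap_dim_le : ∀ (i : ℕ) (t : T.Star i), (dualMap φ ⟨i, t⟩).1 ≤ i
  | 0, _ => le_rfl
  | i + 1, t => by
    rw [dualMap, dualMapAux]
    split_ifs
    · exact le_rfl
    · exact (dualMap_dim_le i (T.dual.γ t)).trans (Nat.le_succ i)

theorem dualMap_succ_of_not {t : T.Star (i + 1)}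
    (h : ¬ ∃ y, IsGreatest {y : S.Star (i + 1) | nodeMap φ.app (i + 1) y ≤ t} y) :
    dualMap φ ⟨i + 1, t⟩ = dualMap φ ⟨i, T.dual.γ t⟩ := dif_neg h

theorem dualMap_eq_iff {t : T.Star i} {x : S.Star i} :
    dualMap φ ⟨i, t⟩ = ⟨i, x⟩ ↔ IsGreatest {y : S.Star i | nodeMap φ.app i y ≤ t} x := by
  cases i with
  | zero =>
    have hg := (exists_isGreatest_zero φ t).choose_spec
    refine mk_eq_mk_iff.trans ⟨?_, fun h => hg.unique h⟩
    rintro rfl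
    exact hg
  | succ i =>
    by_cases h : ∃ y, IsGreatest {y : S.Star (i + 1) | nodeMap φ.app (i + 1) y ≤ t} y
    · have hd : dualMap φ ⟨i + 1, t⟩ = ⟨i + 1, h.choose⟩ := dif_pos h
      rw [hd]
      refine mk_eq_mk_iff.trans ⟨?_, fun h' => h.choose_spec.unique h'⟩
      rintro rfl
      exact h.choose_spec
    · refine iff_of_false (fun h' => ?_) fun h' => h ⟨x, h'⟩
      have := dualMap_dim_le (φ := φ) i (T.dual.γ t)
      rw [← dualMap_succ_of_not h, h'] at this
      simp at this

theorem exists_dualMap_eq {t : T.Star i} {x : S.Star i} (h : nodeMap φ.app i x ≤ t) :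
    ∃ y : S.Star i, dualMap φ ⟨i, t⟩ = ⟨i, y⟩ ∧ x ≤ y := by
  obtain ⟨y, hy⟩ := exists_isGreatest φ h
  exact ⟨y, dualMap_eq_iff.2 hy, hy.2 h⟩

theorem isLowerAdjoint_dualMap (φ : S ⟶ T) : IsLowerAdjoint (dualMap φ) (nodeMap φ.app) where
  le_iff {i x t} := by
    refine ⟨exists_dualMap_eq, ?_⟩
    rintro ⟨y, hy, hxy⟩
    exact ((φ.nodeMap_le_iff i x y).2 hxy).trans (dualMap_eq_iff.1 hy).1
  map_eq x := dualMap_eq_iff.2 ⟨le_refl (nodeMap φ.app _ x), fun y hy => (φ.nodeMap_le_iff _ y x).1 hy⟩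

theorem surjective_dualMap (φ : S ⟶ T) : Function.Surjective (dualMap φ) :=
  fun ⟨i, x⟩ => ⟨⟨i, nodeMap φ.app i x⟩, (isLowerAdjoint_dualMap φ).map_eq x⟩

theorem nodeMap_mem_lvsCircle_iff {α : T.Star (i + 1)} {x : S.Star i} :
    nodeMap φ.app i x ∈ T.lvsCircle α ↔
      ∃ s, x = Node.circle s ∧ nodeMap φ.app (i + 1) (Node.vertex s) ≤ α := by
  cases x with
  | vertex s =>
    refine iff_of_false T.vertex_notMem_lvsCircle ?_
    rintro ⟨_, h, -⟩
    cases h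
  | circle s =>
    refine T.circle_mem_lvsCircle.trans ⟨fun h => ⟨s, rfl, h⟩, ?_⟩
    rintro ⟨_, ⟨⟩, h⟩
    exact h

theorem nodeMap_mem_lvsCircle_iff_of_eq {α : T.Star (i + 1)} {β : S.Star (i + 1)}
    (h : dualMap φ ⟨i + 1, α⟩ = ⟨i + 1, β⟩) {x : S.Star i} :
    nodeMap φ.app i x ∈ T.lvsCircle α ↔ x ∈ S.lvsCircle β := by
  rw [dualMap_eq_iff] at h
  rw [nodeMap_mem_lvsCircle_iff]
  constructor
  · rintro ⟨s, rfl, hs⟩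
    exact S.circle_mem_lvsCircle.2 (h.2 hs)
  · rintro ⟨s, hs, rfl⟩
    exact ⟨s, rfl, ((φ.nodeMap_le_iff _ _ _).2 hs.2).trans h.1⟩

theorem nodeMap_notMem_lvsCircle {α : T.Star (i + 1)} (h : (dualMap φ ⟨i + 1, α⟩).1 ≤ i)
    {x : S.Star i} : nodeMap φ.app i x ∉ T.lvsCircle α := by
  rw [nodeMap_mem_lvsCircle_iff]
  rintro ⟨s, -, hs⟩
  obtain ⟨y, hy, -⟩ := exists_dualMap_eq hs
  rw [hy] at h
  simp at h

theorem dualMap_γ_of_le {α : T.Star (i + 1)} (h : (dualMap φ ⟨i + 1, α⟩).1 ≤ i) :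
    dualMap φ ⟨i, T.dual.γ α⟩ = dualMap φ ⟨i + 1, α⟩ := by
  refine (dualMap_succ_of_not ?_).symm
  rintro ⟨y, hy⟩
  rw [dualMap_eq_iff.2 hy] at h
  simp at h

theorem dualMap_γ_of_eq {α : T.Star (i + 1)} {β : S.Star (i + 1)}
    (h : dualMap φ ⟨i + 1, α⟩ = ⟨i + 1, β⟩) :
    dualMap φ ⟨i, T.dual.γ α⟩ = ⟨i, S.dual.γ β⟩ := by
  have hα := T.isGreatest_dual_γ α
  have hβ := S.isGreatest_dual_γ β
  have hmem := (nodeMap_mem_lvsCircle_iff_of_eq h).2 hβ.1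
  refine dualMap_eq_iff.2 ⟨hα.2 hmem, fun x hx => ?_⟩
  -- The image of `z` lies between an element of `lvs(α)°` and `γ(α)`, so by convexity `z ∈
  -- lvs(β)°`.
  obtain ⟨z, hz⟩ := (S.isTree_star i).exists_sup x (S.dual.γ β)
  have hle : nodeMap φ.app i z ≤ T.dual.γ α := by
    refine (φ.map_sup i _ _ z hz).2 ?_
    rintro w (rfl | rfl)
    exacts [hx, hα.2 hmem]
  refine (hz.1 (by simp) : x ≤ z).trans (hβ.2 ((nodeMap_mem_lvsCircle_iff_of_eq h).1 ?_))
  exact (T.lvsCircle_ordConnected α).out hmem hα.1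
    ⟨(φ.nodeMap_le_iff i _ z).2 (hz.1 (Set.mem_insert_of_mem _ rfl)), hle⟩

theorem mem_δ_of_dualMap_eq {α : T.Star (i + 1)} {β : S.Star (i + 1)}
    (h : dualMap φ ⟨i + 1, α⟩ = ⟨i + 1, β⟩) {a : T.Star i} (ha : a ∈ T.dual.δ α)
    {x : S.Star i} (hx : dualMap φ ⟨i, a⟩ = ⟨i, x⟩) : x ∈ S.dual.δ β := by
  have hT := T.isTree_star i
  have hα := T.isGreatest_dual_γ α
  have hβ := S.isGreatest_dual_γ β
  have hα' := T.lvsCircle_ordConnected α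
  have hg := dualMap_eq_iff.1 hx
  have haγ := T.lt_γ_of_mem_dual_δ ha
  have hγ := dualMap_eq_iff.1 (dualMap_γ_of_eq h)
  have hxβ : x ∉ S.lvsCircle β := fun hxβ =>
    not_le_of_mem_cvr hα' hα ha ((nodeMap_mem_lvsCircle_iff_of_eq h).2 hxβ) hg.1
  have hxγ : @LT.lt (S.Star i) _ x (S.dual.γ β) :=
    lt_of_le_of_ne (hγ.2 (le_trans (α := T.Star i) hg.1 haγ.le)) fun he => hxβ (he ▸ hβ.1)
  -- As `x` is greatest with image below `a`, the image of `z` is strictly above `a`. It is also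
  -- below `γ(α)`, hence in `lvs(α)°`.
  obtain ⟨z, hxz, hz⟩ := (S.isTree_star i).exists_covBy_le hxγ
  have hza : ¬ nodeMap φ.app i z ≤ a := fun hza => hxz.lt.not_ge (hg.2 hza)
  have haz : a < nodeMap φ.app i z := by
    rcases hT.comparable a _ _ hg.1 ((φ.nodeMap_le_iff i x z).2 hxz.le) with h' | h'
    · exact lt_of_le_of_ne h' fun he => hza he.ge
    · exact (hza h').elim
  refine ⟨⟨z, (nodeMap_mem_lvsCircle_iff_of_eq h).1 ?_, hxz⟩, hxβ⟩
  exact hT.mem_of_mem_cvr_of_lt hα' hα ha haz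
    (le_trans (α := T.Star i) ((φ.nodeMap_le_iff i z _).2 hz) hγ.1)

theorem exists_δ_of_dualMap_eq {α : T.Star (i + 1)} {β : S.Star (i + 1)}
    (h : dualMap φ ⟨i + 1, α⟩ = ⟨i + 1, β⟩) {y : S.Star i} (hy : y ∈ S.dual.δ β) :
    ∃ a ∈ T.dual.δ α, dualMap φ ⟨i, a⟩ = ⟨i, y⟩ := by
  have hα := T.isGreatest_dual_γ α
  have hα' := T.lvsCircle_ordConnected α
  obtain ⟨⟨x, hx, hyx⟩, hyβ⟩ := hy
  have hxα := (nodeMap_mem_lvsCircle_iff_of_eq h).2 hx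
  obtain ⟨a, ha, hya⟩ := T.exists_mem_dual_δ (mt (nodeMap_mem_lvsCircle_iff_of_eq h).1 hyβ)
    (((φ.nodeMap_le_iff i y x).2 hyx.le).trans (hα.2 hxα))
  refine ⟨a, ha, dualMap_eq_iff.2 ⟨hya, fun w hw => ?_⟩⟩
  -- If `z` were strictly above `y` it would be above `x`, putting an element of `lvs(α)°` below its
  -- cover element `a`.
  obtain ⟨z, hz⟩ := (S.isTree_star i).exists_sup y w
  have hza : nodeMap φ.app i z ≤ a := by
    refine (φ.map_sup i _ _ z hz).2 ?_
    rintro v (rfl | rfl)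
    exacts [hya, hw]
  have hyz : y ≤ z := hz.1 (by simp)
  have hwz : w ≤ z := hz.1 (by simp)
  rcases hyz.eq_or_lt with rfl | hyz
  · exact hwz
  · refine (not_le_of_mem_cvr hα' hα ha hxα (le_trans ?_ hza)).elim
    exact (φ.nodeMap_le_iff i x z).2 ((S.isTree_star i).le_of_covBy_of_lt hyx hyz)

theorem isContraction_dualMap (φ : S ⟶ T) : IsContraction (dualMap φ) := by
  refine IsContraction.of_faces dualMap_dim_le (fun i α β => dualMap_γ_of_eq)
    (fun i α => dualMap_γ_of_le) (fun i α β h a ha x => mem_δ_of_dualMap_eq h ha)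
    (fun i α β h y => exists_δ_of_dualMap_eq h) ?_ ?_ ?_
  · intro i α a ha b hb x hx hy
    exact T.eq_of_mem_dual_δ ha hb (dualMap_eq_iff.1 hx).1 (dualMap_eq_iff.1 hy).1
  · intro i α y hy
    have hle : (dualMap φ ⟨i + 1, α⟩).1 ≤ i := by rw [hy]
    have hγ := dualMap_eq_iff.1 ((dualMap_γ_of_le hle).trans hy)
    obtain ⟨a, ha, hya⟩ := T.exists_mem_dual_δ (nodeMap_notMem_lvsCircle hle) hγ.1
    have hay : dualMap φ ⟨i, a⟩ = ⟨i, y⟩ := dualMap_eq_iff.2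
      ⟨hya, fun w hw => hγ.2 (le_trans (α := T.Star i) hw (T.lt_γ_of_mem_dual_δ ha).le)⟩
    refine ⟨⟨a, ha, hay⟩, fun b hb x hx => ?_⟩
    have hxb := (dualMap_eq_iff.1 hx).1
    have hxy := hγ.2 (le_trans (α := T.Star i) hxb (T.lt_γ_of_mem_dual_δ hb).le)
    have hab : a = b :=
      T.eq_of_mem_dual_δ ha hb (((φ.nodeMap_le_iff i x y).2 hxy).trans hya) hxb
    subst hab
    exact mk_eq_mk_iff.1 (hx.symm.trans hay)
  · intro i α a ha x hx
    by_contra! hlt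
    -- A collapsing `α` shares its value with `γ(α)`; that value has dimension `i`, since `γ(α)`
    -- lies above `a`.
    obtain ⟨y, hy, -⟩ := exists_dualMap_eq (le_trans (α := T.Star i) (dualMap_eq_iff.1 hx).1
      (T.lt_γ_of_mem_dual_δ ha).le)
    rw [← dualMap_γ_of_le hlt.le, hy] at hlt
    exact lt_irrefl i hlt

end DualMap

end TreeComplex

/-! ### The two functors -/

namespace PositiveOpetope

variable (P : PositiveOpetope.{u})

/-- The nodes of the tree complex of `P` correspond to the faces of `P`. -/
noncomputable def nodeEquiv (k : ℕ) : P.treeComplex.Star k ≃ P.face k :=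
  Equiv.ofBijective (P.ofNode k) ⟨ofNode_injective, ofNode_surjective⟩

/-- The faces of the double dual of `P` correspond to the faces of `P`. -/
noncomputable def facesEquiv : P.treeComplex.dual.Faces ≃ P.Faces :=
  Equiv.sigmaCongrRight P.nodeEquiv

theorem isContraction_facesEquiv : IsContraction P.facesEquiv :=
  IsContraction.of_bijective (P := P.treeComplex.dual) P.ofNode (fun k => (P.nodeEquiv k).bijective)
    (fun _ => ofNode_dual_γ) (fun _ _ _ => ofNode_mem_δ_iff)

theorem isContraction_facesEquiv_symm : IsContraction P.facesEquiv.symm := by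
  refine IsContraction.of_bijective (Q := P.treeComplex.dual) (fun k => (P.nodeEquiv k).symm)
    (fun k => (P.nodeEquiv k).symm.bijective) ?_ ?_
  · intro k α
    refine (Equiv.symm_apply_eq _).2 ?_
    refine Eq.trans ?_ (ofNode_dual_γ _).symm
    exact congrArg P.γ ((P.nodeEquiv (k + 1)).apply_symm_apply α).symm
  · intro k α a
    refine ofNode_mem_δ_iff.symm.trans ?_
    have h₁ := (P.nodeEquiv k).apply_symm_apply a
    have h₂ := (P.nodeEquiv (k + 1)).apply_symm_apply α
    change P.ofNode k _ = _ at h₁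
    change P.ofNode (k + 1) _ = _ at h₂
    rw [h₁, h₂]

variable {P} {Q : PositiveOpetope.{u}}

/-- A contraction epimorphism, transferred to double duals. -/
noncomputable def conj (f : P ⟶ Q) (x : P.treeComplex.dual.Faces) : Q.treeComplex.dual.Faces :=
  Q.facesEquiv.symm (f.toFun (P.facesEquiv x))

theorem facesEquiv_conj (f : P ⟶ Q) (x : P.treeComplex.dual.Faces) :
    Q.facesEquiv (conj f x) = f.toFun (P.facesEquiv x) :=
  Q.facesEquiv.apply_symm_apply _

theorem isContraction_conj (f : P ⟶ Q) : IsContraction (conj f) :=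
  Q.isContraction_facesEquiv_symm.comp (f.isContraction.comp P.isContraction_facesEquiv)

theorem surjective_conj (f : P ⟶ Q) : Function.Surjective (conj f) :=
  Q.facesEquiv.symm.surjective.comp (f.surjective.comp P.facesEquiv.surjective)

/-- The tree complex embedding induced by a contraction epimorphism. -/
noncomputable def dualHom (f : P ⟶ Q) : Q.treeComplex ⟶ P.treeComplex :=
  (TreeComplex.exists_hom_isLowerAdjoint (isContraction_conj f) (surjective_conj f)).choose

theorem isLowerAdjoint_dualHom (f : P ⟶ Q) :
    TreeComplex.IsLowerAdjoint (conj f) (TreeComplex.nodeMap (dualHom f).app) :=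
  (TreeComplex.exists_hom_isLowerAdjoint (isContraction_conj f) (surjective_conj f)).choose_spec

theorem dualHom_app_eq_iff (f : P ⟶ Q) (i : ℕ) (q : Q.Dual i) (p : P.Dual i) :
    (dualHom f).app i q = p ↔ f.toFun ⟨i, p.1⟩ = ⟨i, q.1⟩ := by
  refine (isLowerAdjoint_dualHom f).app_eq_iff.trans ?_
  rw [← Q.facesEquiv.injective.eq_iff, facesEquiv_conj]
  rfl

end PositiveOpetope

open PositiveOpetope in
/-- The construction of tree complexes from positive opetopes. -/
noncomputable def opetopeToTree : OpetopeToTree.{u} where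
  isTreeComplex := isTreeComplex_dual
  map := dualHom
  map_eq_iff := dualHom_app_eq_iff
  map_id P := TreeComplex.Hom.ext (funext fun i => funext fun q =>
    (dualHom_app_eq_iff (𝟙 P) i q q).2 rfl)
  map_comp {P Q R} f g := by
    refine TreeComplex.Hom.ext (funext fun i => funext fun r => ?_)
    refine (dualHom_app_eq_iff (f ≫ g) i r _).2 ?_
    exact (congrArg g.toFun ((dualHom_app_eq_iff f i ((dualHom g).app i r) _).1 rfl)).trans
      ((dualHom_app_eq_iff g i r _).1 rfl)

/-! ### Identity and composition of lower adjoints -/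

namespace TreeComplex

variable {S T U : TreeComplex.{u}}

theorem IsLowerAdjoint.id : IsLowerAdjoint (id : S.dual.Faces → S.dual.Faces)
    (nodeMap (Hom.app (𝟙 S))) where
  le_iff {i x t} := by
    have : nodeMap (Hom.app (𝟙 S)) i x = x := nodeMap_id i x
    rw [this]
    refine ⟨fun h => ⟨t, rfl, h⟩, ?_⟩
    rintro ⟨y, hy, hxy⟩
    rwa [mk_eq_mk_iff.1 hy]
  map_eq {i} x := mk_eq_mk_iff.2 (nodeMap_id i x)

theorem IsLowerAdjoint.comp {f : S ⟶ T} {g : T ⟶ U} {F : T.dual.Faces → S.dual.Faces}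
    {F' : U.dual.Faces → T.dual.Faces} (hf : IsLowerAdjoint F (nodeMap f.app))
    (hF : IsContraction F) (hF' : IsContraction F')
    (hg : IsLowerAdjoint F' (nodeMap g.app)) :
    IsLowerAdjoint (F ∘ F') (nodeMap (Hom.app (f ≫ g))) where
  le_iff {i x t} := by
    have : nodeMap (Hom.app (f ≫ g)) i x = nodeMap g.app i (nodeMap f.app i x) :=
      nodeMap_comp f.app g.app i x
    rw [this, hg.le_iff]
    constructor
    · rintro ⟨y, hy, hxy⟩
      obtain ⟨z, hz, hxz⟩ := hf.le_iff.1 hxy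
      exact ⟨z, (congrArg F hy).trans hz, hxz⟩
    · rintro ⟨z, hz, hxz⟩
      have hz' : F (F' ⟨i, t⟩) = ⟨i, z⟩ := hz
      -- Contractions never raise the dimension, so `F'` already keeps the dimension of `t`.
      have h₁ := hF.dim_le (F' ⟨i, t⟩)
      rw [hz'] at h₁
      obtain ⟨y, hy⟩ := exists_eq_mk (le_antisymm (hF'.dim_le ⟨i, t⟩) h₁)
      rw [hy] at hz'
      exact ⟨y, hy, hf.le_iff.2 ⟨z, hz', hxz⟩⟩
  map_eq {i} x := by
    have : nodeMap (Hom.app (f ≫ g)) i x = nodeMap g.app i (nodeMap f.app i x) :=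
      nodeMap_comp f.app g.app i x
    rw [this]
    exact (congrArg F (hg.map_eq _)).trans (hf.map_eq x)

end TreeComplex

/-- The construction of positive opetopes from tree complexes. -/
noncomputable def treeToOpetope : TreeToOpetope.{u} where
  isOpetope := TreeComplex.isPositiveOpetope_dual
  map φ := ⟨TreeComplex.dualMap φ, TreeComplex.isContraction_dualMap φ,
    TreeComplex.surjective_dualMap φ⟩
  map_eq_iff φ := (TreeComplex.isLowerAdjoint_dualMap φ).map_eq_iff_isDualImage
    (TreeComplex.isContraction_dualMap φ)
  -- Both functor laws hold because the two sides are contractions with the same lower adjoint.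
  map_id _ := ContractionEpi.ext (TreeComplex.IsLowerAdjoint.contraction_ext
    (TreeComplex.isContraction_dualMap _) IsContraction.id
    (TreeComplex.isLowerAdjoint_dualMap _) TreeComplex.IsLowerAdjoint.id)
  map_comp f g := ContractionEpi.ext (TreeComplex.IsLowerAdjoint.contraction_ext
    (TreeComplex.isContraction_dualMap _)
    ((TreeComplex.isContraction_dualMap f).comp (TreeComplex.isContraction_dualMap g))
    (TreeComplex.isLowerAdjoint_dualMap _)
    ((TreeComplex.isLowerAdjoint_dualMap f).comp (TreeComplex.isContraction_dualMap f)
      (TreeComplex.isContraction_dualMap g) (TreeComplex.isLowerAdjoint_dualMap g)))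

/-! ### The natural isomorphisms -/

/-- The natural isomorphism from the double dual of a positive opetope. -/
noncomputable def epsilonIso :
    opetopeToTree.{u}.functor ⋙ treeToOpetope.functor ≅ 𝟭 PositiveOpetope.{u} :=
  NatIso.ofComponents
    (fun P =>
      { hom := ⟨P.facesEquiv, P.isContraction_facesEquiv, P.facesEquiv.surjective⟩
        inv := ⟨P.facesEquiv.symm, P.isContraction_facesEquiv_symm, P.facesEquiv.symm.surjective⟩
        hom_inv_id := ContractionEpi.ext (funext P.facesEquiv.symm_apply_apply)
        inv_hom_id := ContractionEpi.ext (funext P.facesEquiv.apply_symm_apply) })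
    (fun {P Q} f => ContractionEpi.ext (funext fun x => by
      -- Naturality again reduces to uniqueness of the contraction with a given lower adjoint.
      have h : TreeComplex.dualMap (PositiveOpetope.dualHom f) = PositiveOpetope.conj f :=
        TreeComplex.IsLowerAdjoint.contraction_ext (TreeComplex.isContraction_dualMap _)
          (PositiveOpetope.isContraction_conj f) (TreeComplex.isLowerAdjoint_dualMap _)
          (PositiveOpetope.isLowerAdjoint_dualHom f)
      exact (congrArg Q.facesEquiv (congrFun h x)).trans (PositiveOpetope.facesEquiv_conj f x)))

/-! ### The double dual of a tree complex -/

namespace TreeComplex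

variable {S T : TreeComplex.{u}}

theorem nodeMap_equiv_le_iff (e : ∀ i, S.T i ≃ T.T i)
    (hle : ∀ i a b, e i a ≤ e i b ↔ a ≤ b)
    (hσ : ∀ i a b, e i b ∈ T.σ i (e (i + 1) a) ↔ b ∈ S.σ i a) (i : ℕ) (x y : S.Star i) :
    nodeMap (fun i => e i) i x ≤ nodeMap (fun i => e i) i y ↔ x ≤ y := by
  cases x with
  | circle a =>
    cases y with
    | circle b => exact hle (i + 1) a b
    | vertex b => exact Iff.rfl
  | vertex a =>
    cases y with
    | circle b => exact hσ i b a
    | vertex b => exact (e i).apply_eq_iff_eq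

/-- The morphism of tree complexes given by compatible order isomorphisms. -/
def homOfEquiv (e : ∀ i, S.T i ≃ T.T i) (hle : ∀ i a b, e i a ≤ e i b ↔ a ≤ b)
    (hσ : ∀ i a b, e i b ∈ T.σ i (e (i + 1) a) ↔ b ∈ S.σ i a) : S ⟶ T where
  app i := e i
  app_le_iff := hle
  nodeMap_le_iff := nodeMap_equiv_le_iff e hle hσ
  map_sup i x y z h := by
    have hs : Function.Surjective (nodeMap (S := S) (T := T) (fun i => e i) i) := by
      rintro (a | a)
      · exact ⟨.circle ((e (i + 1)).symm a), congrArg _ ((e _).apply_symm_apply a)⟩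
      · exact ⟨.vertex ((e i).symm a), congrArg _ ((e _).apply_symm_apply a)⟩
    have hn := nodeMap_equiv_le_iff e hle hσ i
    rw [isLUB_iff_le_iff] at h ⊢
    intro w
    obtain ⟨w, rfl⟩ := hs w
    rw [hn, h]
    simp [hn]

/-- The isomorphism of tree complexes given by compatible order isomorphisms. -/
def isoOfEquiv (e : ∀ i, S.T i ≃ T.T i) (hle : ∀ i a b, e i a ≤ e i b ↔ a ≤ b)
    (hσ : ∀ i a b, e i b ∈ T.σ i (e (i + 1) a) ↔ b ∈ S.σ i a) : S ≅ T where
  hom := homOfEquiv e hle hσ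
  inv := homOfEquiv (fun i => (e i).symm) (fun i a b => by rw [← hle]; simp)
    (fun i a b => by rw [← hσ]; simp)
  hom_inv_id := Hom.ext (funext fun i => funext (e i).symm_apply_apply)
  inv_hom_id := Hom.ext (funext fun i => funext (e i).apply_symm_apply)

variable (S)

/-- The positive opetope of a tree complex. -/
noncomputable def opetope : PositiveOpetope.{u} := ⟨S.dual, S.isPositiveOpetope_dual⟩

theorem vertex_mem_verts {i : ℕ} (s : S.T i) :
    (Node.vertex s : S.Star i) ∈ S.opetope.verts i := by
  rintro ⟨α, h⟩
  obtain ⟨t, -, ht⟩ := (S.isGreatest_dual_γ α).1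
  cases h.symm.trans ht

/-- The elements of a tree complex are the faces of its dual which are not codomains. -/
noncomputable def doubleDualEquiv (i : ℕ) : S.T i ≃ S.opetope.Dual i :=
  Equiv.ofBijective (fun s => ⟨(Node.vertex s : S.Star i), S.vertex_mem_verts s⟩) (by
    constructor
    · intro s t h
      have h' : (Node.vertex s : S.Star i) = Node.vertex t := congrArg Subtype.val h
      cases h'
      rfl
    · rintro ⟨x, hx⟩
      cases x with
      | circle t => exact (hx ⟨(Node.vertex t : S.Star (i + 1)), S.dual_γ_vertex t⟩).elim
      | vertex t => exact ⟨t, rfl⟩)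

theorem doubleDualEquiv_le_iff (i : ℕ) (a b : S.T i) :
    S.doubleDualEquiv i a ≤ S.doubleDualEquiv i b ↔ a ≤ b := by
  cases i with
  | zero =>
    have := (Nat.card_eq_one_iff_unique.1 S.isTreeComplex.bottom).1
    rw [Subsingleton.elim a b]
    exact iff_of_true le_rfl le_rfl
  | succ i =>
    rw [PositiveOpetope.dual_le_iff, PositiveOpetope.ule_iff, ← S.circle_le_circle, le_iff_eq_or_lt]
    have key : ∀ a : S.T (i + 1),
        S.opetope.γ (S.doubleDualEquiv (i + 1) a).1 = (Node.circle a : S.Star i) :=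
      S.dual_γ_vertex
    rw [key, key]
    exact or_congr Iff.rfl S.dual_upper_iff

theorem doubleDualEquiv_mem_iff (i : ℕ) (a : S.T (i + 1)) (b : S.T i) :
    S.doubleDualEquiv i b ∈ S.opetope.dual.σ i (S.doubleDualEquiv (i + 1) a) ↔ b ∈ S.σ i a := by
  rw [← S.vertex_le_circle, le_iff_eq_or_lt, or_iff_right (by simp), ← S.dual_upper_iff,
    ← S.dual_γ_vertex]
  rfl

end TreeComplex

/-- The natural isomorphism to the double dual of a tree complex. -/
noncomputable def etaIso :
    𝟭 TreeComplex.{u} ≅ treeToOpetope.{u}.functor.rightOp ⋙ opetopeToTree.functor.leftOp :=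
  NatIso.ofComponents
    (fun S => TreeComplex.isoOfEquiv (T := S.opetope.treeComplex) S.doubleDualEquiv
      S.doubleDualEquiv_le_iff S.doubleDualEquiv_mem_iff)
    (fun {S T} f => TreeComplex.Hom.ext (funext fun i => funext fun s =>
      -- Naturality says that `f*` sends the vertex of `f(s)` to the vertex of `s`: the lower
      -- adjoint is a section.
      ((opetopeToTree.map_eq_iff (treeToOpetope.map f) i (S.doubleDualEquiv i s)
        (T.doubleDualEquiv i (f.app i s))).2
          ((TreeComplex.isLowerAdjoint_dualMap f).map_eq (Node.vertex s : S.Star i))).symm))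

end OpetopeDuality

open OpetopeDuality
theorem theorem1 :
    ∃ (A : OpetopeToTree.{u}) (B : TreeToOpetope.{u})
      (ε : A.functor ⋙ B.functor ≅ 𝟭 PositiveOpetope.{u})
      (η : 𝟭 TreeComplex.{u} ≅ B.functor.rightOp ⋙ A.functor.leftOp),
      (∀ P : PositiveOpetope.{u}, (ε.hom.app P).toFun = epsilonFun A P) ∧
      (∀ (S : TreeComplex.{u}) (i : ℕ) (s : S.T i),
        ((η.hom.app S).app i s).1 = (Node.vertex s : S.Star i)) ∧
      ∃ e : PositiveOpetope.{u} ≌ TreeComplex.{u}ᵒᵖ,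
        e.functor = A.functor ∧ e.inverse = B.functor := by
  refine ⟨opetopeToTree, treeToOpetope, epsilonIso, etaIso, ?_, fun S i s => rfl, ?_⟩
  · intro P
    funext ⟨i, x⟩
    cases x <;> rfl
  -- The inverse of `ε` and the opposite of `η` suffice; no triangle identity has to be checked for
  -- them.
  · exact ⟨CategoryTheory.Equivalence.mk _ _ epsilonIso.symm
      (NatIso.ofComponents (fun S => (etaIso.app S.unop).op)
        (fun f => congrArg Quiver.Hom.op (etaIso.hom.naturality f.unop).symm)), rfl, rfl⟩
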